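/- **Setting.** Let $\mathcal X,\mathcal Y$ be topological spaces with definite CNT (conditionally negative type) costs $c_{\mathcal X},c_{\mathcal Y}$. That is, $c$ is continuous, symmetric and real-valued, $c(x,x')=0$ if and only if $x=x'$, and $\sum_{i,j}\lambda_i\lambda_j\,c(x_i,x_j)\le 0$ for all finitely many points $x_i$ and reals $\lambda_i$ with $\sum_i\lambda_i=0$. Let $\alpha,\beta$ be Borel probability measures on $\mathcal X,\mathcal Y$, each carried by a compact set, and let $\mathcal M(\alpha,\beta)$ be the set of couplings of $\alpha$ and $\beta$. For $\tau\ge 0$ put $$\mathrm{GW}_\tau(\alpha,\beta)=\inf_{\pi\in\mathcal M(\alpha,\beta)}\ \iint \big(c_{\mathcal X}(x,x')-c_{\mathcal Y}(y,y')\big)^2\,d\pi(x,y)\,d\pi(x',y')+\tau\,\mathrm{KL}(\pi\,|\,\alpha\otimes\beta),$$ with $0\cdot\infty=0$. **Embeddings.** Let $\varphi:\mathcal X\to\mathcal H_{\mathcal X}$ and $\psi:\mathcal Y\to\mathcal H_{\mathcal Y}$ be maps into real Hilbert spaces with $c_{\mathcal X}(x,x')=\|\varphi(x)-\varphi(x')\|^2$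 and $c_{\mathcal Y}(y,y')=\|\psi(y)-\psi(y')\|^2$, centred so that $\int\varphi\,d\alpha=0$ and $\int\psi\,d\beta=0$. The GW-embeddings are $$\Phi(x)=\big(\varphi(x),\tfrac12\|\varphi(x)\|^2\big)\in\mathcal H_{\mathcal X}\oplus\mathbb R,\qquad \Psi(y)=\big(\psi(y),\tfrac12\|\psi(y)\|^2\big)\in\mathcal H_{\mathcal Y}\oplus\mathbb R.$$ **Functional.** For a Hilbert–Schmidt operator $\Gamma:\mathcal H_{\mathcal Y}\to\mathcal H_{\mathcal X}$, let $\overline\Gamma(v,t)=(\Gamma v,t)$ be its extension to $\mathcal H_{\mathcal Y}\oplus\mathbb R\to\mathcal H_{\mathcal X}\oplus\mathbb R$. Let $\Phi(x)\Psi(y)^\top$ be the rank-one operator $w\mapsto\langle\Psi(y),w\rangle\,\Phi(x)$, and let $\langle S,T\rangle_{\mathrm{HS}}=\sum_i\langle Se_i,Te_i\rangle$ for an orthonormal basis $(e_i)$. For $\varepsilon\ge 0$ and $\pi\in\mathcal M(\alpha,\beta)$ put $$\mathcal F(\Gamma,\pi)=\|\Gamma\|_{\mathrm{HS}}^2+\varepsilon\,\mathrm{KL}(\pi\,|\,\alpha\otimes\beta)-2\int\big\langle\overline\Gamma,\Phi(x)\Psi(y)^\top\big\rangle_{\mathrm{HS}}\,d\pi(x,y).$$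 **Theorem.** For every $\varepsilon\ge 0$, the integrals in $\mathcal F$ converge absolutely, both minima below are attained and finite, and $$\mathrm{GW}_{8\varepsilon}(\alpha,\beta)=C(\alpha,\beta)+8\,\min_{\Gamma\ \text{Hilbert–Schmidt}}\ \min_{\pi\in\mathcal M(\alpha,\beta)}\mathcal F(\Gamma,\pi),$$ where the constant, which does not depend on $\varepsilon$, is $$C(\alpha,\beta)=\iint\|\varphi(x)-\varphi(x')\|^4\,d\alpha\,d\alpha+\iint\|\psi(y)-\psi(y')\|^4\,d\beta\,d\beta-4\int\|\varphi\|^2\,d\alpha\int\|\psi\|^2\,d\beta .$$ (Equivalently, the value $\mathrm{GW}_\varepsilon$, with penalty $\varepsilon\,\mathrm{KL}$, is obtained by replacing $\varepsilon$ with $\varepsilon/8$ in $\mathcal F$.) -/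

import Mathlib

open MeasureTheory
open scoped ENNReal RealInnerProductSpace

universe u

noncomputable section

namespace EGW

/-! ### Costs of conditionally negative type -/

/-- A definite cost of conditionally negative type (CNT) on a topological space: a continuous
symmetric function, zero on the diagonal and only there, such that
`∑ᵢⱼ λᵢ λⱼ c(xᵢ, xⱼ) ≤ 0` whenever `∑ᵢ λᵢ = 0`. -/
structure IsDefiniteCNT {X : Type*} [TopologicalSpace X] (c : X → X → ℝ) : Prop where
  continuous : Continuous fun p : X × X => c p.1 p.2
  symm : ∀ x x', c x x' = c x' x
  self : ∀ x, c x x = 0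
  condNeg : ∀ (s : Finset X) (l : X → ℝ), ∑ x ∈ s, l x = 0 →
    ∑ x ∈ s, ∑ x' ∈ s, l x * l x' * c x x' ≤ 0
  definite : ∀ x x', c x x' = 0 → x = x'

/-- The measure `α` is carried by a compact set. -/
def HasCompactSupport {X : Type*} [TopologicalSpace X] [MeasurableSpace X] (α : Measure X) :
    Prop :=
  ∃ K : Set X, IsCompact K ∧ α Kᶜ = 0

/-! ### Embeddings -/

/-- `φ` is a Hilbert space embedding of the cost `c`, `c(x, x') = ‖φ(x) - φ(x')‖²`, centred
with respect to `α`. -/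
structure IsCentredEmbedding {X H : Type*} [MeasurableSpace X] [NormedAddCommGroup H]
    [InnerProductSpace ℝ H] (c : X → X → ℝ) (α : Measure X) (φ : X → H) : Prop where
  cost_eq : ∀ x x', c x x' = ‖φ x - φ x'‖ ^ 2
  integrable : Integrable φ α
  centred : ∫ x, φ x ∂α = 0

/-- The kernel `½ (c(x, o) + c(y, o) - c(x, y))` attached to a cost `c` and a base point `o`. -/
def baseKernel {X : Type*} (c : X → X → ℝ) (o : X) : Matrix X X (ℝ →L[ℝ] ℝ) :=
  fun x y => ((1 / 2) * (c x o + c y o - c x y)) • ContinuousLinearMap.id ℝ ℝ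

theorem IsDefiniteCNT.posSemidef_baseKernel {X : Type*} [TopologicalSpace X] {c : X → X → ℝ}
    (hc : IsDefiniteCNT c) (o : X) : (baseKernel c o).PosSemidef := by
  classical
  have htfae : (baseKernel c o).PosSemidef ↔ (baseKernel c o).IsHermitian ∧ ∀ v : X →₀ ℝ,
      0 ≤ RCLike.re (v.sum fun x w => v.sum fun x' w' => inner ℝ (baseKernel c o x' x w) w') :=
    (RKHS.posSemidef_tfae (K := baseKernel c o)).out 0 2
  refine htfae.mpr ⟨?_, fun v => ?_⟩
  · ext x y
    have hid : (ContinuousLinearMap.adjoint (ContinuousLinearMap.id ℝ ℝ)) 1 = (1 : ℝ) :=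
      ext_inner_right ℝ fun v => by rw [ContinuousLinearMap.adjoint_inner_left]; rfl
    simp [baseKernel, Matrix.conjTranspose_apply, ContinuousLinearMap.star_eq_adjoint,
      hc.symm x y, hid]
    ring
  · set s := insert o v.support with hs
    have hsum : ∀ (g : X → ℝ → ℝ), (∀ x, g x 0 = 0) → v.sum g = ∑ x ∈ s, g x (v x) :=
      fun g hg => Finsupp.sum_of_support_subset v (Finset.subset_insert _ _) g fun x _ => hg x
    have ho : o ∈ s := Finset.mem_insert_self _ _
    set L := ∑ x ∈ s, v x with hL
    have h := hc.condNeg s (fun x => v x - if x = o then L else 0) (by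
      rw [Finset.sum_sub_distrib, Finset.sum_ite_eq' s o, if_pos ho, sub_self])
    have e1 : ∀ x, ∑ x' ∈ s, (v x' - if x' = o then L else 0) * c x x'
        = ∑ x' ∈ s, v x' * c x x' - L * c x o := by
      intro x
      simp [sub_mul, Finset.sum_sub_distrib, ite_mul, ho]
    have e2 : ∑ x ∈ s, ∑ x' ∈ s, (v x - if x = o then L else 0) *
          (v x' - if x' = o then L else 0) * c x x'
        = ∑ x ∈ s, ∑ x' ∈ s, v x * v x' * c x x' - 2 * L * ∑ x ∈ s, v x * c x o := by
      simp only [mul_assoc, ← Finset.mul_sum, e1]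
      simp only [sub_mul, Finset.sum_sub_distrib, ite_mul, zero_mul, Finset.sum_ite_eq', ho,
        if_true, hc.self, mul_sub, hc.symm o]
      simp only [mul_left_comm _ L, ← Finset.mul_sum]
      ring
    rw [e2] at h
    have e3 : (v.sum fun x w => v.sum fun x' w' => inner ℝ (baseKernel c o x' x w) w')
        = ∑ x ∈ s, ∑ x' ∈ s, v x * v x' * ((1 / 2) * (c x' o + c x o - c x' x)) := by
      rw [hsum _ (by simp)]
      refine Finset.sum_congr rfl fun x _ => ?_
      rw [hsum _ (by simp)]
      refine Finset.sum_congr rfl fun x' _ => ?_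
      simp [baseKernel]
      ring
    have e4 : ∑ x ∈ s, ∑ x' ∈ s, v x * v x' * ((1 / 2) * (c x' o + c x o - c x' x))
        = L * ∑ x ∈ s, v x * c x o
          - (1 / 2) * ∑ x ∈ s, ∑ x' ∈ s, v x * v x' * c x x' := by
      have a1 : ∑ x ∈ s, ∑ x' ∈ s, v x * (v x' * c x' o) = L * ∑ x ∈ s, v x * c x o := by
        rw [hL, Finset.sum_mul_sum]
      have a2 : ∑ x ∈ s, ∑ x' ∈ s, (v x * c x o) * v x' = L * ∑ x ∈ s, v x * c x o := by
        rw [mul_comm, hL, Finset.sum_mul_sum]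
      have : ∀ x x', v x * v x' * ((1 / 2) * (c x' o + c x o - c x' x))
          = (1 / 2) * (v x * (v x' * c x' o)) + (1 / 2) * ((v x * c x o) * v x')
            - (1 / 2) * (v x * v x' * c x x') := by
        intro x x'
        rw [hc.symm x' x]
        ring
      simp only [this, Finset.sum_sub_distrib, Finset.sum_add_distrib, ← Finset.mul_sum]
      simp only [← Finset.mul_sum] at a1 a2
      simp only [a1, a2]
      ring
    rw [RCLike.re_to_real, e3, e4]
    linarith

/-- Centred embeddings exist. -/
theorem IsDefiniteCNT.exists_isCentredEmbedding {X : Type u} [TopologicalSpace X]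
    [MeasurableSpace X] [BorelSpace X] {c : X → X → ℝ} (hc : IsDefiniteCNT c) (α : Measure X)
    [IsProbabilityMeasure α] (hα : HasCompactSupport α) :
    ∃ (H : Type u) (_ : NormedAddCommGroup H) (_ : InnerProductSpace ℝ H) (_ : CompleteSpace H)
      (φ : X → H), IsCentredEmbedding c α φ := by
  obtain ⟨o⟩ : Nonempty X := α.nonempty_of_neZero
  have : Fact (baseKernel c o).PosSemidef := ⟨hc.posSemidef_baseKernel o⟩
  let H := RKHS.OfKernel (baseKernel c o)
  let f : X → H := fun x => RKHS.kerFun H x 1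
  have hf : ∀ x y, inner ℝ (f x) (f y) = (1 / 2) * (c x o + c y o - c x y) := by
    intro x y
    have h := RKHS.kernel_inner (H := H) y x (1 : ℝ) 1
    rw [RKHS.OfKernel.kernel_ofKernel] at h
    simp only [f, ← h]
    simp [baseKernel, hc.symm y x]
    ring
  have hcost : ∀ x y, c x y = ‖f x - f y‖ ^ 2 := by
    intro x y
    rw [norm_sub_sq_real, ← real_inner_self_eq_norm_sq, ← real_inner_self_eq_norm_sq, hf, hf, hf,
      hc.self, hc.self]
    ring
  have hcont : Continuous f := by
    rw [continuous_iff_continuousAt]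
    intro x
    rw [ContinuousAt, tendsto_iff_norm_sub_tendsto_zero]
    have h1 : Continuous fun y => √(c y x) :=
      (hc.continuous.comp (continuous_id.prodMk continuous_const)).sqrt
    have h2 := h1.tendsto x
    simpa only [hcost,
      Real.sqrt_sq (norm_nonneg (_ : H)), sub_self, norm_zero, zero_pow two_ne_zero, Real.sqrt_zero] using h2
  have hinj : Function.Injective f := fun x y h => hc.definite x y (by rw [hcost, h]; simp)
  have : T2Space X := T2Space.of_injective_continuous hinj hcont
  obtain ⟨K, hK, hK0⟩ := hα
  have hint : Integrable f α := by
    have h := hcont.continuousOn.integrableOn_compact (μ := α) hK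
    rwa [IntegrableOn, Measure.restrict_eq_self_of_ae_mem] at h
    exact mem_ae_iff.mpr hK0
  refine ⟨H, inferInstance, inferInstance, inferInstance, fun x => f x - ∫ y, f y ∂α,
    fun x y => by rw [hcost, sub_sub_sub_cancel_right], hint.sub (integrable_const _), ?_⟩
  rw [integral_sub hint (integrable_const _)]
  simp

/-- The lifted map `Φ(x) = (φ(x), ½‖φ(x)‖²)`, with values in the Hilbert space `H ⊕ ℝ`. It is the
GW-embedding when `φ` is a centred embedding. -/
def gwLift {X H : Type*} [NormedAddCommGroup H] (φ : X → H) (x : X) : WithLp 2 (H × ℝ) :=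
  WithLp.toLp 2 (φ x, (1 / 2) * ‖φ x‖ ^ 2)

/-! ### Hilbert–Schmidt operators -/

/-- Parseval's identity, in `[0, ∞]`. -/
theorem ofReal_norm_sq_eq_tsum {ι G : Type*} [NormedAddCommGroup G]
    [InnerProductSpace ℝ G] (e : HilbertBasis ι ℝ G) (v : G) :
    ENNReal.ofReal (‖v‖ ^ 2) = ∑' i, ENNReal.ofReal (⟪v, e i⟫ ^ 2) := by
  have h := e.hasSum_inner_mul_inner v v
  simp only [real_inner_self_eq_norm_sq, fun i => real_inner_comm v (e i), ← pow_two] at h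
  rw [← h.tsum_eq, ENNReal.ofReal_tsum_of_nonneg (fun _ => sq_nonneg _) h.summable]

section HilbertSchmidt

variable (G : Type*) [NormedAddCommGroup G] [InnerProductSpace ℝ G] [CompleteSpace G]

/-- The index set of the chosen orthonormal basis of a Hilbert space. -/
def basisIndex : Set G := (exists_hilbertBasis ℝ G).choose

/-- A chosen orthonormal (Hilbert) basis of a Hilbert space. -/
def stdBasis : HilbertBasis (basisIndex G) ℝ G := (exists_hilbertBasis ℝ G).choose_spec.choose

end HilbertSchmidt

section HilbertSchmidt

variable {G H : Type*} [NormedAddCommGroup G] [InnerProductSpace ℝ G] [CompleteSpace G]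
  [NormedAddCommGroup H] [InnerProductSpace ℝ H]

/-- `T` is a Hilbert–Schmidt operator: `∑ᵢ ‖T eᵢ‖² < ∞`. -/
def IsHilbertSchmidt (T : G →L[ℝ] H) : Prop := Summable fun i => ‖T (stdBasis G i)‖ ^ 2

/-- The squared Hilbert–Schmidt norm `∑ᵢ ‖T eᵢ‖²`. -/
def hsNormSq (T : G →L[ℝ] H) : ℝ := ∑' i, ‖T (stdBasis G i)‖ ^ 2

/-- The Hilbert–Schmidt scalar product `∑ᵢ ⟨S eᵢ, T eᵢ⟩`. -/
def hsInner (S T : G →L[ℝ] H) : ℝ := ∑' i, ⟪S (stdBasis G i), T (stdBasis G i)⟫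

theorem tsum_ofReal_norm_sq_adjoint [CompleteSpace H] {ι : Type*} (T : G →L[ℝ] H)
    (e : HilbertBasis ι ℝ G) :
    ∑' i, ENNReal.ofReal (‖T (e i)‖ ^ 2)
      = ∑' j, ENNReal.ofReal (‖T.adjoint (stdBasis H j)‖ ^ 2) := by
  rw [tsum_congr fun i => ofReal_norm_sq_eq_tsum (stdBasis H) (T (e i)), ENNReal.tsum_comm]
  refine tsum_congr fun j => ?_
  rw [ofReal_norm_sq_eq_tsum e]
  refine tsum_congr fun i => ?_
  rw [ContinuousLinearMap.adjoint_inner_left, real_inner_comm]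

/-- The squared Hilbert–Schmidt norm, and hence the Hilbert–Schmidt property, do not depend on the
choice of the orthonormal basis. -/
theorem tsum_ofReal_norm_sq_eq [CompleteSpace H] {ι ι' : Type*} (T : G →L[ℝ] H)
    (b : HilbertBasis ι ℝ G) (b' : HilbertBasis ι' ℝ G) :
    ∑' i, ENNReal.ofReal (‖T (b i)‖ ^ 2) = ∑' i, ENNReal.ofReal (‖T (b' i)‖ ^ 2) := by
  rw [tsum_ofReal_norm_sq_adjoint T b, tsum_ofReal_norm_sq_adjoint T b']

end HilbertSchmidt

section Operators

variable {G H : Type*} [NormedAddCommGroup G] [InnerProductSpace ℝ G]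
  [NormedAddCommGroup H] [InnerProductSpace ℝ H]

/-- The operator `Γ̄ = Γ ⊕ 1 : G ⊕ ℝ → H ⊕ ℝ`, `(v, t) ↦ (Γ v, t)`. -/
def extend (Γ : G →L[ℝ] H) : WithLp 2 (G × ℝ) →L[ℝ] WithLp 2 (H × ℝ) :=
  (WithLp.prodContinuousLinearEquiv 2 ℝ H ℝ).symm.toContinuousLinearMap ∘L
    (Γ.prodMap (ContinuousLinearMap.id ℝ ℝ)) ∘L
      (WithLp.prodContinuousLinearEquiv 2 ℝ G ℝ).toContinuousLinearMap

theorem extend_apply (Γ : G →L[ℝ] H) (v : G) (t : ℝ) :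
    extend Γ (WithLp.toLp 2 (v, t)) = WithLp.toLp 2 (Γ v, t) := rfl

/-- The rank-one operator `u vᵀ : G → H`, `w ↦ ⟨v, w⟩ u`. -/
def outer (u : H) (v : G) : G →L[ℝ] H := InnerProductSpace.rankOne ℝ u v

theorem outer_apply (u : H) (v w : G) : outer u v w = ⟪v, w⟫ • u := by
  simp [outer]

end Operators

/-! ### The entropic Gromov–Wasserstein problem -/

section GW

variable {X Y : Type*} [MeasurableSpace X] [MeasurableSpace Y]

/-- Couplings: measures on the product whose marginals are `α` and `β`. -/
def couplings (α : Measure X) (β : Measure Y) : Set (Measure (X × Y)) :=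
  {π | π.map Prod.fst = α ∧ π.map Prod.snd = β}

/-- The Gromov–Wasserstein loss `∫∫ (c_X(x, x') - c_Y(y, y'))² dπ(x, y) dπ(x', y')`. -/
def gwLoss (cX : X → X → ℝ) (cY : Y → Y → ℝ) (π : Measure (X × Y)) : ℝ≥0∞ :=
  ∫⁻ p, ∫⁻ q, ENNReal.ofReal ((cX p.1 q.1 - cY p.2 q.2) ^ 2) ∂π ∂π

/-- The entropic Gromov–Wasserstein cost
`inf_π ∫∫ (c_X(x, x') - c_Y(y, y'))² dπ dπ + τ KL(π | α ⊗ β)`. -/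
def entropicGW (cX : X → X → ℝ) (cY : Y → Y → ℝ) (α : Measure X) (β : Measure Y) (τ : ℝ) :
    ℝ≥0∞ :=
  ⨅ π ∈ couplings α β,
    (gwLoss cX cY π + ENNReal.ofReal τ * InformationTheory.klDiv π (α.prod β))

variable {H K : Type*} [NormedAddCommGroup H] [InnerProductSpace ℝ H] [NormedAddCommGroup K]
  [InnerProductSpace ℝ K] [CompleteSpace K]

/-- The additive constant `C(α, β)`. -/
def gwConst (α : Measure X) (β : Measure Y) (φ : X → H) (ψ : Y → K) : ℝ :=
  (∫ x, ∫ x', ‖φ x - φ x'‖ ^ 4 ∂α ∂α) + (∫ y, ∫ y', ‖ψ y - ψ y'‖ ^ 4 ∂β ∂β)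
    - 4 * (∫ x, ‖φ x‖ ^ 2 ∂α) * (∫ y, ‖ψ y‖ ^ 2 ∂β)

/-- The integrand `⟨Γ̄, Φ(x) Ψ(y)ᵀ⟩_HS`. -/
def alignment (φ : X → H) (ψ : Y → K) (Γ : K →L[ℝ] H) (p : X × Y) : ℝ :=
  hsInner (extend Γ) (outer (gwLift φ p.1) (gwLift ψ p.2))

/-- The functional
`F(Γ, π) = ‖Γ‖²_HS + ε KL(π | α ⊗ β) - 2 ∫ ⟨Γ̄, Φ(x) Ψ(y)ᵀ⟩_HS dπ(x, y)`,
with values in the extended reals as the relative entropy may be infinite. -/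
def functional (α : Measure X) (β : Measure Y) (φ : X → H) (ψ : Y → K) (ε : ℝ)
    (Γ : K →L[ℝ] H) (π : Measure (X × Y)) : EReal :=
  ((hsNormSq Γ : ℝ) : EReal)
    + ((ENNReal.ofReal ε * InformationTheory.klDiv π (α.prod β) : ℝ≥0∞) : EReal)
    - ((2 * ∫ p, alignment φ ψ Γ p ∂π : ℝ) : EReal)

end GW

end EGW

end

/-! Expand the square in the loss. The terms in `cX ^ 2` and `cY ^ 2` see only the marginals. In the
cross term `‖φ - φ'‖² ‖ψ - ψ'‖²`, centring removes every contribution that is linear in a single `φ`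
or `ψ`, and `⟪φ, φ'⟫ ⟪ψ, ψ'⟫` is the Hilbert–Schmidt product of `φ ψᵀ` and `φ' ψ'ᵀ`. Writing `V_π =
∫ φ ψᵀ dπ`, this gives the loss as `C + 8 R(π)` with `R(π) = -‖V_π‖² - ½ ∫ ‖φ‖² ‖ψ‖² dπ`
(`integral_cost_mul_cost`, `gwLoss_eq`).

The concave term `-‖V_π‖²` is the minimum over `Γ` of `‖Γ‖² - 2⟪Γ, V_π⟫`, and the last coordinates
of `Φ` and `Ψ` supply the other term of `R`. Hence `F(Γ, π) = ε KL + R(π) + ‖Γ - V_π‖²`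
(`functional_eq`), and minimizing over `Γ` leaves `ε KL + R`. The operator `V_π` is itself
Hilbert–Schmidt, so the minimum is attained.

Minimizers in `π` exist because couplings on compact metrizable spaces form a weakly compact set,
`R` and the linear term are weakly continuous, and the entropy is lower semicontinuous by
Donsker–Varadhan duality. The general case reduces to this one: a definite cost makes the embedding
continuous and injective, so a compact carrier is metrizable, and every quantity is preserved by
pushforward along its inclusion. -/

namespace EGW

open InformationTheory Filter Topology BoundedContinuousFunction

/-! ### Variational duality and lower semicontinuity of the relative entropy -/

section KullbackLeibler

variable {Z : Type*} [MeasurableSpace Z]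

/-- The Donsker–Varadhan functional `∫ f dπ - ∫ (exp f - 1) dμ`. -/
noncomputable def dualKL (π μ : Measure Z) (f : Z → ℝ) : ℝ :=
  ∫ z, f z ∂π - ∫ z, (Real.exp (f z) - 1) ∂μ

/-- Fenchel–Young inequality for `klFun`, whose convex conjugate is `exp t - 1`. For `r > 0` it is
`s + 1 ≤ exp s` at `s = t - log r`, multiplied by `r`. -/
theorem young_klFun {r : ℝ} (hr : 0 ≤ r) (t : ℝ) : r * t - Real.exp t + 1 ≤ klFun r := by
  rcases hr.eq_or_lt with rfl | hr
  · simp [klFun_zero, Real.exp_nonneg]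
  · have h := Real.add_one_le_exp (t - Real.log r)
    rw [Real.exp_sub, Real.exp_log hr, le_div_iff₀ hr] at h
    rw [klFun_apply]
    linarith

theorem dualKL_eq_integral {π μ : Measure Z} [IsProbabilityMeasure π] [IsFiniteMeasure μ]
    (h : π ≪ μ) {f : Z → ℝ} (hf : Measurable f) {M : ℝ} (hM : ∀ z, |f z| ≤ M) :
    Integrable (fun z => (π.rnDeriv μ z).toReal * f z - Real.exp (f z) + 1) μ ∧
      dualKL π μ f = ∫ z, ((π.rnDeriv μ z).toReal * f z - Real.exp (f z) + 1) ∂μ := by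
  have h1 : Integrable (fun z => (π.rnDeriv μ z).toReal * f z) μ := by
    refine (Measure.integrable_toReal_rnDeriv (μ := π) (ν := μ)).mul_bdd (c := M)
      hf.aestronglyMeasurable (ae_of_all _ fun z => hM z)
  have h2 : Integrable (fun z => Real.exp (f z)) μ :=
    Integrable.of_bound (by fun_prop) (Real.exp M) (ae_of_all _ fun z => by
      rw [Real.norm_eq_abs, Real.abs_exp]
      exact Real.exp_le_exp.2 ((le_abs_self _).trans (hM z)))
  refine ⟨(h1.sub h2).add (integrable_const _), ?_⟩
  have h3 : ∫ z, f z ∂π = ∫ z, (π.rnDeriv μ z).toReal * f z ∂μ :=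
    (integral_rnDeriv_smul h (f := f)).symm
  have h4 : Integrable (fun z => Real.exp (f z) - 1) μ := h2.sub (integrable_const _)
  rw [dualKL, h3, ← integral_sub h1 h4]
  congr 1
  ext z
  ring

theorem dualKL_le_klDiv (π μ : Measure Z) [IsProbabilityMeasure π] [IsFiniteMeasure μ]
    {f : Z → ℝ} (hf : Measurable f) {M : ℝ} (hM : ∀ z, |f z| ≤ M) :
    ENNReal.ofReal (dualKL π μ f) ≤ klDiv π μ := by
  by_cases hac : π ≪ μ
  swap
  · simp [klDiv_of_not_ac hac]
  obtain ⟨h1, h2⟩ := dualKL_eq_integral hac hf hM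
  rw [h2, klDiv_eq_lintegral_klFun_of_ac hac]
  have h3 := integral_eq_lintegral_pos_part_sub_lintegral_neg_part h1
  refine (ENNReal.ofReal_le_of_le_toReal
    (h3.le.trans (sub_le_self _ ENNReal.toReal_nonneg))).trans ?_
  refine lintegral_mono fun z => ENNReal.ofReal_le_ofReal ?_
  exact young_klFun ENNReal.toReal_nonneg _

/-- Equality in Young's inequality holds at `f = log (dπ/dμ)`. This `f` may be unbounded, so the
density is truncated and Fatou's lemma recovers the full entropy. Without absolute continuity, a
large multiple of the indicator of a `μ`-null set charged by `π` does the job. -/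
theorem exists_measurable_lt_dualKL {π μ : Measure Z} [IsProbabilityMeasure π]
    [IsFiniteMeasure μ] {c : ℝ≥0∞} (hc : c < klDiv π μ) :
    ∃ f : Z → ℝ, Measurable f ∧ (∃ M, ∀ z, |f z| ≤ M) ∧ c < ENNReal.ofReal (dualKL π μ f) := by
  by_cases hac : π ≪ μ
  · set r : Z → ℝ := fun z => (π.rnDeriv μ z).toReal with hr
    have hr0 : ∀ z, 0 ≤ r z := fun z => ENNReal.toReal_nonneg
    have hrm : Measurable r := (Measure.measurable_rnDeriv _ _).ennreal_toReal
    -- The density clamped to `[1/(n+1), n+1]`, an interval containing `1`, so that its logarithm is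
    -- bounded.
    set a : ℕ → Z → ℝ := fun n z => max ((n + 1 : ℝ)⁻¹) (min (r z) (n + 1)) with ha
    have hn : ∀ n : ℕ, (0 : ℝ) < n + 1 := fun n => by positivity
    have ha0 : ∀ n z, 0 < a n z := fun n z => lt_max_of_lt_left (inv_pos.2 (hn n))
    have hinv : ∀ n : ℕ, (n + 1 : ℝ)⁻¹ ≤ n + 1 := fun n =>
      (inv_le_one_of_one_le₀ (by simp)).trans (by simp)
    set f : ℕ → Z → ℝ := fun n z => Real.log (a n z) with hf
    have hfm : ∀ n, Measurable (f n) := fun n => by fun_prop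
    have hfb : ∀ n z, |f n z| ≤ Real.log (n + 1) := by
      intro n z
      rw [abs_le, ← Real.log_inv]
      exact ⟨Real.log_le_log (inv_pos.2 (hn n)) (le_max_left _ _),
        Real.log_le_log (ha0 n z) (max_le (hinv n) (min_le_right _ _))⟩
    have hlim : ∀ z, Tendsto (fun n => ENNReal.ofReal (r z * f n z - Real.exp (f n z) + 1)) atTop
        (𝓝 (ENNReal.ofReal (klFun (r z)))) := by
      intro z
      refine ENNReal.tendsto_ofReal ?_
      have hai : Tendsto (fun n : ℕ => ((n : ℝ) + 1)⁻¹) atTop (𝓝 0) := by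
        simpa using tendsto_one_div_add_atTop_nhds_zero_nat (𝕜 := ℝ)
      rcases (hr0 z).eq_or_lt with h0 | h0
      · have : ∀ n, r z * f n z - Real.exp (f n z) + 1 = -(n + 1 : ℝ)⁻¹ + 1 := by
          intro n
          have : a n z = (n + 1 : ℝ)⁻¹ := by
            simp only [ha, ← h0]
            rw [min_eq_left (hn n).le, max_eq_left (inv_pos.2 (hn n)).le]
          rw [← h0, show Real.exp (f n z) = a n z from Real.exp_log (ha0 n z), this]
          ring
        rw [funext this, ← h0, klFun_zero]
        simpa using hai.neg.add_const 1
      · refine tendsto_const_nhds.congr' ?_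
        have e1 : ∀ᶠ n : ℕ in atTop, ((n : ℝ) + 1)⁻¹ < r z := hai.eventually_lt_const h0
        have e2 : ∀ᶠ n : ℕ in atTop, r z < n := tendsto_natCast_atTop_atTop.eventually_gt_atTop _
        filter_upwards [e1, e2] with n h1 h2
        have : a n z = r z := by
          simp only [ha]
          rw [min_eq_left (by linarith), max_eq_right h1.le]
        simp only [hf, this, Real.exp_log h0, klFun_apply]
        ring
    have hfatou : klDiv π μ ≤ liminf (fun n => ENNReal.ofReal (dualKL π μ (f n))) atTop := by
      -- Fatou needs nonnegative integrands. Clamping moves `r` towards `1`, so `r - a` and `log a`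
      -- never have opposite signs, and the integrand is at least `klFun a ≥ 0`.
      have hnn : ∀ n z, 0 ≤ r z * f n z - Real.exp (f n z) + 1 := by
        intro n z
        simp only [hf, Real.exp_log (ha0 n z)]
        have key : klFun (a n z) ≤ r z * Real.log (a n z) - a n z + 1 := by
          rw [klFun_apply]
          have : 0 ≤ (r z - a n z) * Real.log (a n z) := by
            rcases lt_or_ge (r z) (n + 1 : ℝ)⁻¹ with h | h
            · have e : a n z = (n + 1 : ℝ)⁻¹ := by
                simp only [ha]
                rw [max_eq_left ((min_le_left _ _).trans h.le)]
              rw [e]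
              refine mul_nonneg_of_nonpos_of_nonpos (by linarith) ?_
              rw [Real.log_inv]
              exact neg_nonpos.2 (Real.log_nonneg (by simp))
            · rcases le_or_gt (r z) (n + 1) with h' | h'
              · have e : a n z = r z := by
                  simp only [ha]
                  rw [min_eq_left h', max_eq_right h]
                simp [e]
              · have e : a n z = n + 1 := by
                  simp only [ha]
                  rw [min_eq_right h'.le, max_eq_right (hinv n)]
                rw [e]
                exact mul_nonneg (by linarith) (Real.log_nonneg (by simp))
          linarith
        exact (klFun_nonneg (ha0 n z).le).trans key
      have e : ∀ n, ENNReal.ofReal (dualKL π μ (f n))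
          = ∫⁻ z, ENNReal.ofReal (r z * f n z - Real.exp (f n z) + 1) ∂μ := by
        intro n
        obtain ⟨h1, h2⟩ := dualKL_eq_integral hac (hfm n) (hfb n)
        rw [h2, ofReal_integral_eq_lintegral_ofReal h1 (ae_of_all _ (hnn n))]
      rw [klDiv_eq_lintegral_klFun_of_ac hac]
      simp only [e]
      refine le_trans (le_of_eq ?_) (lintegral_liminf_le fun n => by fun_prop)
      exact lintegral_congr fun z => (hlim z).liminf_eq.symm
    obtain ⟨n, hn⟩ := (eventually_lt_of_lt_liminf (hc.trans_le hfatou)).exists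
    exact ⟨f n, hfm n, ⟨_, hfb n⟩, hn⟩
  · obtain ⟨A, hA, hμA, hπA⟩ : ∃ A, MeasurableSet A ∧ μ A = 0 ∧ π A ≠ 0 := by
      by_contra! h
      exact hac (Measure.AbsolutelyContinuous.mk fun s hs h0 => h s hs h0)
    have hcT : c ≠ ∞ := hc.ne_top
    have hpos : 0 < π.real A := ENNReal.toReal_pos hπA (measure_ne_top _ _)
    -- Chosen so that `∫ f dπ = c + 1`; the exponential term vanishes because `A` is `μ`-null.
    set t : ℝ := (c.toReal + 1) / π.real A with ht
    refine ⟨A.indicator fun _ => t, measurable_const.indicator hA, ⟨|t|, fun z => ?_⟩, ?_⟩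
    · by_cases hz : z ∈ A <;> simp [hz]
    · have h0 : ∫ z, (Real.exp (A.indicator (fun _ => t) z) - 1) ∂μ = 0 := by
        rw [← integral_zero Z ℝ (μ := μ)]
        refine integral_congr_ae ?_
        have : ∀ᵐ z ∂μ, z ∉ A := measure_eq_zero_iff_ae_notMem.1 hμA
        filter_upwards [this] with z hz
        simp [hz]
      rw [dualKL, h0, integral_indicator_const _ hA, smul_eq_mul, ht, mul_div_cancel₀ _ hpos.ne',
        sub_zero, ENNReal.lt_ofReal_iff_toReal_lt hcT]
      linarith

variable [TopologicalSpace Z] [BorelSpace Z] [TopologicalSpace.PseudoMetrizableSpace Z]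

/-- Bounded continuous functions are dense in `L¹(π + μ)`, and `dualKL` is Lipschitz for that norm
among functions bounded above by `M`, with constant `1 + exp M`. -/
theorem exists_continuous_lt_dualKL {π μ : Measure Z} [IsProbabilityMeasure π]
    [IsFiniteMeasure μ] {c : ℝ≥0∞} (hc : c < klDiv π μ) :
    ∃ g : Z →ᵇ ℝ, c < ENNReal.ofReal (dualKL π μ g) := by
  obtain ⟨f, hf, ⟨M, hM⟩, hlt⟩ := exists_measurable_lt_dualKL hc
  rw [ENNReal.lt_ofReal_iff_toReal_lt hc.ne_top] at hlt
  have hfi : Integrable f (π + μ) :=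
    Integrable.of_bound hf.aestronglyMeasurable M (ae_of_all _ hM)
  -- With this tolerance, replacing `f` by `g` costs at most half of the gap above `c`.
  set δ := (dualKL π μ f - c.toReal) / 2 / (1 + Real.exp M) with hδ
  have hE : 0 < 1 + Real.exp M := by positivity
  have hδ0 : 0 < δ := div_pos (half_pos (sub_pos.2 hlt)) hE
  obtain ⟨g₀, hg₀, hg₀i⟩ := hfi.exists_boundedContinuous_integral_sub_le hδ0
  -- Clipping to `[-M, M]` keeps the exponential Lipschitz, and brings `g₀` no further from `f`,
  -- which already takes values there.
  set g : Z →ᵇ ℝ := BoundedContinuousFunction.ofNormedAddCommGroup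
    (fun z => max (min (g₀ z) M) (-M)) (by fun_prop) |M| (fun z => by
      have hM0 : 0 ≤ M := (abs_nonneg _).trans (hM z)
      rw [Real.norm_eq_abs, abs_of_nonneg hM0, abs_le]
      exact ⟨le_max_right _ _, max_le (min_le_right _ _) (by linarith)⟩) with hg
  have hgM : ∀ z, g z ≤ M := fun z =>
    max_le (min_le_right _ _) (by linarith [(abs_nonneg _).trans (hM z)])
  have hclip : ∀ z, |f z - g z| ≤ |f z - g₀ z| := by
    intro z
    have e : f z = max (min (f z) M) (-M) := by
      have := abs_le.1 (hM z)
      rw [min_eq_left this.2, max_eq_left this.1]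
    have : g z = max (min (g₀ z) M) (-M) := rfl
    rw [this]
    conv_lhs => rw [e]
    exact (abs_max_sub_max_le_abs _ _ _).trans (abs_inf_sub_inf_le_abs _ _ _)
  refine ⟨g, ?_⟩
  rw [ENNReal.lt_ofReal_iff_toReal_lt hc.ne_top]
  have hgi : Integrable g (π + μ) := g.integrable _
  have hdi : Integrable (fun z => |f z - g z|) (π + μ) := (hfi.sub hgi).abs
  have hd : ∫ z, |f z - g z| ∂(π + μ) ≤ δ :=
    (integral_mono hdi (hfi.sub hg₀i).abs hclip).trans hg₀
  rw [integral_add_measure hdi.left_of_add_measure hdi.right_of_add_measure] at hd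
  have hn1 : 0 ≤ ∫ z, |f z - g z| ∂π := integral_nonneg fun z => abs_nonneg _
  have hn2 : 0 ≤ ∫ z, |f z - g z| ∂μ := integral_nonneg fun z => abs_nonneg _
  have h1 : ∫ z, f z ∂π - ∫ z, g z ∂π ≤ ∫ z, |f z - g z| ∂π := by
    rw [← integral_sub hfi.left_of_add_measure hgi.left_of_add_measure]
    exact integral_mono (hfi.sub hgi).left_of_add_measure hdi.left_of_add_measure
      fun z => le_abs_self _
  have hexp : ∀ {a b : ℝ}, a ≤ M → b ≤ M → Real.exp b - Real.exp a ≤ Real.exp M * |a - b| := by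
    intro a b ha hb
    have h := Real.add_one_le_exp (a - b)
    have e : Real.exp a = Real.exp b * Real.exp (a - b) := by rw [← Real.exp_add]; ring_nf
    have hb' := Real.exp_le_exp.2 hb
    have hbp := Real.exp_pos b
    calc Real.exp b - Real.exp a ≤ Real.exp b * (b - a) := by rw [e]; nlinarith
      _ ≤ Real.exp b * |a - b| := by
        gcongr
        rw [abs_sub_comm]
        exact le_abs_self _
      _ ≤ _ := by gcongr
  have hei : ∀ {u : Z → ℝ}, Measurable u → (∀ z, u z ≤ M) →
      Integrable (fun z => Real.exp (u z) - 1) μ := by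
    intro u hu huM
    refine (Integrable.of_bound (by fun_prop) (Real.exp M) (ae_of_all _ fun z => ?_)).sub
      (integrable_const _)
    rw [Real.norm_eq_abs, Real.abs_exp]
    exact Real.exp_le_exp.2 (huM z)
  have hfe := hei hf fun z => (le_abs_self _).trans (hM z)
  have hge := hei g.continuous.measurable hgM
  have h2 : ∫ z, (Real.exp (g z) - 1) ∂μ - ∫ z, (Real.exp (f z) - 1) ∂μ
      ≤ Real.exp M * ∫ z, |f z - g z| ∂μ := by
    rw [← integral_sub hge hfe, ← integral_const_mul]
    refine integral_mono (hge.sub hfe) (hdi.right_of_add_measure.const_mul _) fun z => ?_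
    have := hexp ((le_abs_self _).trans (hM z)) (hgM z)
    simp only
    linarith
  have h3 : dualKL π μ f - dualKL π μ g ≤ (1 + Real.exp M) * δ := by
    simp only [dualKL]
    nlinarith [Real.exp_pos M]
  have h4 : (1 + Real.exp M) * δ = (dualKL π μ f - c.toReal) / 2 := by
    rw [hδ]
    field_simp
  linarith

/-- The relative entropy is lower semicontinuous for the weak topology. -/
theorem lowerSemicontinuous_klDiv (μ : Measure Z) [IsFiniteMeasure μ] :
    LowerSemicontinuous fun ρ : ProbabilityMeasure Z => klDiv (ρ : Measure Z) μ := by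
  intro ρ c hc
  -- One test function witnesses the strict bound at `ρ`. Its dual value is weakly continuous, so
  -- the bound persists nearby.
  obtain ⟨g, hg⟩ := exists_continuous_lt_dualKL hc
  have hcont : Continuous fun ρ : ProbabilityMeasure Z =>
      ENNReal.ofReal (dualKL (ρ : Measure Z) μ g) :=
    ENNReal.continuous_ofReal.comp
      ((ProbabilityMeasure.continuous_integral_boundedContinuousFunction g).sub continuous_const)
  filter_upwards [hcont.continuousAt.eventually_const_lt hg] with ρ' h
  exact h.trans_le (dualKL_le_klDiv _ _ g.continuous.measurable (M := ‖g‖) g.norm_coe_le_norm)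

end KullbackLeibler

end EGW

namespace EGW

open InformationTheory Filter Topology

/-! ### Existence of optimal couplings -/

section Minimizers

variable {X Y : Type*} [MeasurableSpace X] [MeasurableSpace Y]

theorem isProbabilityMeasure_of_mem_couplings {α : Measure X} {β : Measure Y}
    [IsProbabilityMeasure α] {π : Measure (X × Y)} (hπ : π ∈ couplings α β) :
    IsProbabilityMeasure π := by
  have : IsProbabilityMeasure (π.map Prod.fst) := by rw [hπ.1]; infer_instance
  exact Measure.isProbabilityMeasure_of_map Prod.fst

theorem prod_mem_couplings (α : Measure X) (β : Measure Y) [IsProbabilityMeasure α]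
    [IsProbabilityMeasure β] : α.prod β ∈ couplings α β := by
  constructor <;> simp

variable [TopologicalSpace X] [BorelSpace X] [TopologicalSpace.MetrizableSpace X]
  [CompactSpace X]
  [TopologicalSpace Y] [BorelSpace Y] [TopologicalSpace.MetrizableSpace Y]
  [SecondCountableTopology Y] [CompactSpace Y]

/-- An entropic transport problem whose objective is weakly continuous has a
solution. -/
theorem exists_minimizer_couplings (α : Measure X) (β : Measure Y) [IsProbabilityMeasure α]
    [IsProbabilityMeasure β] (ε : ℝ) (J : Measure (X × Y) → ℝ)
    (hJ : Continuous fun ρ : ProbabilityMeasure (X × Y) => J ρ) :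
    ∃ π ∈ couplings α β, ∀ π' ∈ couplings α β,
      ((ENNReal.ofReal ε * klDiv π (α.prod β) : ℝ≥0∞) : EReal) + (J π : EReal)
        ≤ ((ENNReal.ofReal ε * klDiv π' (α.prod β) : ℝ≥0∞) : EReal) + (J π' : EReal) := by
  let S : Set (ProbabilityMeasure (X × Y)) := {ρ | (ρ : Measure (X × Y)) ∈ couplings α β}
  have hfst := ProbabilityMeasure.continuous_map (Ω := X × Y) continuous_fst
  have hsnd := ProbabilityMeasure.continuous_map (Ω := X × Y) continuous_snd
  have hS : IsClosed S := by
    let α' : ProbabilityMeasure X := ⟨α, inferInstance⟩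
    let β' : ProbabilityMeasure Y := ⟨β, inferInstance⟩
    have h1 := isClosed_eq hfst (continuous_const (y := α'))
    have h2 := isClosed_eq hsnd (continuous_const (y := β'))
    convert h1.inter h2 using 1
    ext ρ
    simp only [S, couplings, Set.mem_ofPred_eq, Set.mem_inter_iff]
    exact and_congr ⟨fun h => Subtype.ext h, fun h => congrArg Subtype.val h⟩
      ⟨fun h => Subtype.ext h, fun h => congrArg Subtype.val h⟩
  have hne : S.Nonempty := ⟨⟨α.prod β, inferInstance⟩, prod_mem_couplings α β⟩
  have hkl : LowerSemicontinuous fun ρ : ProbabilityMeasure (X × Y) =>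
      ((ENNReal.ofReal ε * klDiv (ρ : Measure (X × Y)) (α.prod β) : ℝ≥0∞) : EReal) := by
    have hc : Continuous fun t : ℝ≥0∞ => ((ENNReal.ofReal ε * t : ℝ≥0∞) : EReal) :=
      continuous_coe_ennreal_ereal.comp (ENNReal.continuous_const_mul ENNReal.ofReal_ne_top)
    exact hc.comp_lowerSemicontinuous (lowerSemicontinuous_klDiv (α.prod β))
      fun s t hst => EReal.coe_ennreal_le_coe_ennreal_iff.2 (by gcongr)
  have hJ' : LowerSemicontinuous fun ρ : ProbabilityMeasure (X × Y) => (J ρ : EReal) :=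
    (continuous_coe_real_ereal.comp hJ).lowerSemicontinuous
  -- Addition in `EReal` is discontinuous only at `⊤ + ⊥` and `⊥ + ⊤`, which the finiteness of `J`
  -- excludes.
  have hsum := hkl.add' hJ' fun ρ => EReal.continuousAt_add (Or.inr (EReal.coe_ne_bot _))
    (Or.inr (EReal.coe_ne_top _))
  -- Probability measures on a compact metrizable space are weakly compact, hence so is the closed
  -- set `S`.
  obtain ⟨ρ, hρ, hmin⟩ := (hsum.lowerSemicontinuousOn S).exists_isMinOn hne hS.isCompact
  refine ⟨ρ, hρ, fun π' hπ' => ?_⟩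
  have := isProbabilityMeasure_of_mem_couplings hπ'
  exact hmin (show (⟨π', this⟩ : ProbabilityMeasure (X × Y)) ∈ S from hπ')

end Minimizers

end EGW

namespace EGW

/-! ### Hilbert–Schmidt operators as square-summable families -/

section HilbertSchmidt

variable {G H : Type*} [NormedAddCommGroup G] [InnerProductSpace ℝ G] [CompleteSpace G]
  [NormedAddCommGroup H] [InnerProductSpace ℝ H]

/-- Parseval for `⟪T† u, v⟫`. Boundedness of `T` is enough, since the other factor has rank one. -/
theorem hsInner_outer [CompleteSpace H] (T : G →L[ℝ] H) (u : H) (v : G) :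
    hsInner T (outer u v) = ⟪T v, u⟫ := by
  have h := (stdBasis G).tsum_inner_mul_inner (T.adjoint u) v
  rw [ContinuousLinearMap.adjoint_inner_left, real_inner_comm] at h
  rw [hsInner, ← h]
  refine tsum_congr fun i => ?_
  rw [outer_apply, real_inner_smul_right, ContinuousLinearMap.adjoint_inner_left,
    real_inner_comm v, real_inner_comm u, mul_comm]

theorem memℓp_of_isHilbertSchmidt {T : G →L[ℝ] H} (hT : IsHilbertSchmidt T) :
    Memℓp (fun i => T (stdBasis G i)) 2 :=
  memℓp_gen (by simpa [IsHilbertSchmidt] using hT)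

/-- The `ℓ²` family of the images of the basis vectors under a Hilbert–Schmidt operator. -/
noncomputable def hsFamily (T : G →L[ℝ] H) (hT : IsHilbertSchmidt T) :
    lp (fun _ : basisIndex G => H) 2 :=
  ⟨fun i => T (stdBasis G i), memℓp_of_isHilbertSchmidt hT⟩

theorem norm_hsFamily_sq (T : G →L[ℝ] H) (hT : IsHilbertSchmidt T) :
    ‖hsFamily T hT‖ ^ 2 = hsNormSq T := by
  rw [← real_inner_self_eq_norm_sq, lp.inner_eq_tsum]
  exact tsum_congr fun i => real_inner_self_eq_norm_sq _

theorem hasSum_norm_sq_stdBasis (u : H) (v : G) :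
    HasSum (fun i => ‖⟪stdBasis G i, v⟫ • u‖ ^ 2) ((‖u‖ * ‖v‖) ^ 2) := by
  have h := ((stdBasis G).hasSum_inner_mul_inner v v).mul_right (‖u‖ ^ 2)
  rw [real_inner_self_eq_norm_sq] at h
  have e : (fun i => ‖⟪stdBasis G i, v⟫ • u‖ ^ 2)
      = fun i => ⟪v, stdBasis G i⟫ * ⟪stdBasis G i, v⟫ * ‖u‖ ^ 2 := by
    funext i
    rw [norm_smul, real_inner_comm v, mul_pow, Real.norm_eq_abs, sq_abs]
    ring
  rw [e, mul_pow, mul_comm]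
  exact h

/-- The rank-one operator `u vᵀ`, as an `ℓ²` family. -/
noncomputable def outerFamily (u : H) (v : G) : lp (fun _ : basisIndex G => H) 2 :=
  ⟨fun i => ⟪stdBasis G i, v⟫ • u, memℓp_gen (by
    simpa using (hasSum_norm_sq_stdBasis u v).summable)⟩

theorem outerFamily_apply (u : H) (v : G) (i : basisIndex G) :
    outerFamily u v i = ⟪stdBasis G i, v⟫ • u := rfl

theorem norm_outerFamily (u : H) (v : G) : ‖outerFamily u v‖ = ‖u‖ * ‖v‖ := by
  rw [← sq_eq_sq₀ (norm_nonneg _) (by positivity), ← real_inner_self_eq_norm_sq, lp.inner_eq_tsum,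
    ← (hasSum_norm_sq_stdBasis u v).tsum_eq]
  exact tsum_congr fun i => real_inner_self_eq_norm_sq _

/-- Turns the product of two scalar products into a single one, so that a double integral of such
products becomes a squared norm. -/
theorem inner_outerFamily (u u' : H) (v v' : G) :
    ⟪outerFamily u v, outerFamily u' v'⟫ = ⟪u, u'⟫ * ⟪v, v'⟫ := by
  rw [lp.inner_eq_tsum, ← (stdBasis G).tsum_inner_mul_inner, ← tsum_mul_left]
  refine tsum_congr fun i => ?_
  rw [outerFamily_apply, outerFamily_apply, real_inner_smul_left, real_inner_smul_right,
    real_inner_comm v]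
  ring

theorem inner_hsFamily_outerFamily [CompleteSpace H] (T : G →L[ℝ] H) (hT : IsHilbertSchmidt T)
    (u : H) (v : G) : ⟪hsFamily T hT, outerFamily u v⟫ = ⟪T v, u⟫ := by
  rw [← hsInner_outer, lp.inner_eq_tsum, hsInner]
  refine tsum_congr fun i => ?_
  rw [outerFamily_apply, outer_apply, real_inner_comm v]
  rfl

/-- `outerFamily` as a continuous bilinear map. -/
noncomputable def outerFamilyL : H →L[ℝ] G →L[ℝ] lp (fun _ : basisIndex G => H) 2 :=
  LinearMap.mkContinuous₂
    (LinearMap.mk₂ ℝ outerFamily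
      (fun u u' v => by ext i; simp [outerFamily_apply])
      (fun c u v => by ext i; simp [outerFamily_apply, smul_comm c])
      (fun u v v' => by ext i; simp [outerFamily_apply, inner_add_right, add_smul])
      (fun c u v => by ext i; simp [outerFamily_apply, real_inner_smul_right, mul_smul]))
    1 (fun u v => by simp [norm_outerFamily])

theorem continuous_outerFamily : Continuous fun p : H × G => outerFamily p.1 p.2 :=
  (outerFamilyL (G := G) (H := H)).continuous₂

/-- The averaged rank-one operator `∫ u vᵀ dπ` is Hilbert–Schmidt. -/
theorem exists_hsFamily_integral_outerFamily [CompleteSpace H] {Z : Type*} [MeasurableSpace Z]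
    {π : Measure Z} {u : Z → H} {v : Z → G}
    (h : Integrable (fun z => outerFamily (u z) (v z)) π)
    (h' : Integrable (fun z => outer (u z) (v z)) π) :
    ∃ (T : G →L[ℝ] H) (hT : IsHilbertSchmidt T),
      hsFamily T hT = ∫ z, outerFamily (u z) (v z) ∂π := by
  -- Both evaluations are continuous and linear, so they commute with the Bochner integrals. The
  -- integral in operator norm provides the bounded operator, and the `ℓ²` integral provides
  -- square-summability.
  have key : ∀ i, (∫ z, outer (u z) (v z) ∂π : G →L[ℝ] H) (stdBasis G i)
      = (∫ z, outerFamily (u z) (v z) ∂π : lp (fun _ : basisIndex G => H) 2) i := by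
    intro i
    rw [ContinuousLinearMap.integral_apply h']
    have e := (lp.evalCLM ℝ (fun _ : basisIndex G => H) 2 i).integral_comp_comm h
    refine Eq.trans ?_ e
    refine integral_congr_ae (ae_of_all _ fun z => ?_)
    simp only [outer_apply]
    rw [real_inner_comm]
    rfl
  refine ⟨∫ z, outer (u z) (v z) ∂π, ?_, ?_⟩
  · have := (memℓp_gen_iff (by simp)).1
      (lp.memℓp (∫ z, outerFamily (u z) (v z) ∂π : lp (fun _ : basisIndex G => H) 2))
    simpa [IsHilbertSchmidt, key] using this
  · ext i
    exact key i

end HilbertSchmidt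

section Alignment

variable {X Y H K : Type*} [NormedAddCommGroup H] [InnerProductSpace ℝ H] [CompleteSpace H]
  [NormedAddCommGroup K] [InnerProductSpace ℝ K] [CompleteSpace K]

/-- The coefficient `1 / 4` is the product of the two halves in the last coordinates of `Φ` and `Ψ`.
-/
theorem alignment_eq (φ : X → H) (ψ : Y → K) (Γ : K →L[ℝ] H) (p : X × Y) :
    alignment φ ψ Γ p = ⟪Γ (ψ p.2), φ p.1⟫ + 1 / 4 * (‖φ p.1‖ ^ 2 * ‖ψ p.2‖ ^ 2) := by
  rw [alignment, hsInner_outer, gwLift, gwLift, extend_apply, WithLp.prod_inner_apply]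
  simp
  ring

end Alignment

end EGW

/-! ### Expansion of the Gromov–Wasserstein loss -/

namespace EGW

theorem integrable_of_continuous {Z E : Type*} [MeasurableSpace Z] [TopologicalSpace Z]
    [CompactSpace Z] [OpensMeasurableSpace Z] [TopologicalSpace.PseudoMetrizableSpace Z]
    [NormedAddCommGroup E] {f : Z → E} (hf : Continuous f) (μ : Measure Z) [IsFiniteMeasure μ] :
    Integrable f μ :=
  hf.integrable_of_hasCompactSupport (HasCompactSupport.of_compactSpace f)

/-- Integrability travels together with the value, so that long sums can be integrated by nesting
this lemma and its analogues. -/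
theorem integral_add_of_eq {Z : Type*} [MeasurableSpace Z] {μ : Measure Z} {f g : Z → ℝ} {a b : ℝ}
    (hf : Integrable f μ ∧ ∫ z, f z ∂μ = a) (hg : Integrable g μ ∧ ∫ z, g z ∂μ = b) :
    Integrable (fun z => f z + g z) μ ∧ ∫ z, (f z + g z) ∂μ = a + b :=
  ⟨hf.1.add hg.1, by rw [integral_add hf.1 hg.1, hf.2, hg.2]⟩

theorem integral_sub_of_eq {Z : Type*} [MeasurableSpace Z] {μ : Measure Z} {f g : Z → ℝ} {a b : ℝ}
    (hf : Integrable f μ ∧ ∫ z, f z ∂μ = a) (hg : Integrable g μ ∧ ∫ z, g z ∂μ = b) :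
    Integrable (fun z => f z - g z) μ ∧ ∫ z, (f z - g z) ∂μ = a - b :=
  ⟨hf.1.sub hg.1, by rw [integral_sub hf.1 hg.1, hf.2, hg.2]⟩

theorem integral_const_mul_of_eq {Z : Type*} [MeasurableSpace Z] {μ : Measure Z} {f : Z → ℝ} {a : ℝ}
    (hf : Integrable f μ ∧ ∫ z, f z ∂μ = a) (t : ℝ) :
    Integrable (fun z => t * f z) μ ∧ ∫ z, t * f z ∂μ = t * a :=
  ⟨hf.1.const_mul t, by rw [integral_const_mul, hf.2]⟩

theorem integral_const_mul_inner_of_eq {Z E : Type*} [MeasurableSpace Z] {μ : Measure Z}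
    [NormedAddCommGroup E] [InnerProductSpace ℝ E] [CompleteSpace E] {f : Z → E} {m : E}
    (hf : Integrable f μ) (hm : ∫ z, f z ∂μ = m) (t : ℝ) (u : E) :
    Integrable (fun z => t * ⟪u, f z⟫) μ ∧ ∫ z, t * ⟪u, f z⟫ ∂μ = t * ⟪u, m⟫ :=
  ⟨(hf.const_inner (𝕜 := ℝ) u).const_mul t, by rw [integral_const_mul, integral_inner hf, hm]⟩

theorem continuous_outerFamily_comp {X Y H K : Type*} [TopologicalSpace X] [TopologicalSpace Y]
    [NormedAddCommGroup H] [InnerProductSpace ℝ H]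
    [NormedAddCommGroup K] [InnerProductSpace ℝ K] [CompleteSpace K] {φ : X → H} {ψ : Y → K}
    (hφ : Continuous φ) (hψ : Continuous ψ) :
    Continuous fun p : X × Y => outerFamily (φ p.1) (ψ p.2) :=
  continuous_outerFamily.comp (hφ.fst'.prodMk hψ.snd')

theorem integral_fst_of_mem_couplings {X Y E : Type*} [MeasurableSpace X] [MeasurableSpace Y]
    [TopologicalSpace X] [CompactSpace X] [OpensMeasurableSpace X]
    [TopologicalSpace.PseudoMetrizableSpace X] [NormedAddCommGroup E] [NormedSpace ℝ E]
    {α : Measure X} {β : Measure Y} [IsFiniteMeasure α] {π : Measure (X × Y)}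
    (hπ : π ∈ couplings α β) {f : X → E} (hf : Continuous f) :
    ∫ p, f p.1 ∂π = ∫ x, f x ∂α := by
  rw [← hπ.1, integral_map measurable_fst.aemeasurable]
  rw [hπ.1]
  exact (integrable_of_continuous hf α).aestronglyMeasurable

theorem integral_snd_of_mem_couplings {X Y E : Type*} [MeasurableSpace X] [MeasurableSpace Y]
    [TopologicalSpace Y] [CompactSpace Y] [OpensMeasurableSpace Y]
    [TopologicalSpace.PseudoMetrizableSpace Y] [NormedAddCommGroup E] [NormedSpace ℝ E]
    {α : Measure X} {β : Measure Y} [IsFiniteMeasure β] {π : Measure (X × Y)}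
    (hπ : π ∈ couplings α β) {f : Y → E} (hf : Continuous f) :
    ∫ p, f p.2 ∂π = ∫ y, f y ∂β := by
  rw [← hπ.2, integral_map measurable_snd.aemeasurable]
  rw [hπ.2]
  exact (integrable_of_continuous hf β).aestronglyMeasurable

section Expansion

variable {X Y H K : Type*} [MeasurableSpace X] [MeasurableSpace Y]
  [TopologicalSpace X] [BorelSpace X] [TopologicalSpace.MetrizableSpace X]
  [CompactSpace X]
  [TopologicalSpace Y] [BorelSpace Y] [TopologicalSpace.MetrizableSpace Y]
  [SecondCountableTopology Y] [CompactSpace Y]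
  [NormedAddCommGroup H] [InnerProductSpace ℝ H] [CompleteSpace H]
  [NormedAddCommGroup K] [InnerProductSpace ℝ K] [CompleteSpace K]

/-- The reduced objective `-‖∫ φ ψᵀ dπ‖² - ½ ∫ ‖φ‖² ‖ψ‖² dπ`. -/
noncomputable def reducedObjective (φ : X → H) (ψ : Y → K) (π : Measure (X × Y)) : ℝ :=
  -‖∫ p, outerFamily (φ p.1) (ψ p.2) ∂π‖ ^ 2 - 1 / 2 * ∫ p, ‖φ p.1‖ ^ 2 * ‖ψ p.2‖ ^ 2 ∂π

/-- Integrating in `q`, then in `p`, the nine terms of the product: four products of squared norms,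
four terms linear in one scalar product, and `4 ⟪V p, V q⟫`. Centring removes the linear ones, two
in each integration. -/
theorem integral_cost_mul_cost {φ : X → H} {ψ : Y → K} (hφ : Continuous φ) (hψ : Continuous ψ)
    {α : Measure X} {β : Measure Y} [IsProbabilityMeasure α] [IsProbabilityMeasure β]
    {π : Measure (X × Y)} (hπ : π ∈ couplings α β)
    (hφ0 : ∫ x, φ x ∂α = 0) (hψ0 : ∫ y, ψ y ∂β = 0) :
    ∫ p, ∫ q, ‖φ p.1 - φ q.1‖ ^ 2 * ‖ψ p.2 - ψ q.2‖ ^ 2 ∂π ∂π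
      = 2 * ∫ p, ‖φ p.1‖ ^ 2 * ‖ψ p.2‖ ^ 2 ∂π
        + 2 * ((∫ x, ‖φ x‖ ^ 2 ∂α) * ∫ y, ‖ψ y‖ ^ 2 ∂β)
        + 4 * ‖∫ p, outerFamily (φ p.1) (ψ p.2) ∂π‖ ^ 2 := by
  have := isProbabilityMeasure_of_mem_couplings hπ
  set V : X × Y → lp (fun _ : basisIndex K => H) 2 := fun p => outerFamily (φ p.1) (ψ p.2) with hV
  have hVc : Continuous V := continuous_outerFamily_comp hφ hψ
  set w : X × Y → ℝ := fun p => ‖φ p.1‖ ^ 2 * ‖ψ p.2‖ ^ 2 with hw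
  set m₁ : K := ∫ q, ‖φ q.1‖ ^ 2 • ψ q.2 ∂π with hm₁
  set m₂ : H := ∫ q, ‖ψ q.2‖ ^ 2 • φ q.1 ∂π with hm₂
  set A := ∫ x, ‖φ x‖ ^ 2 ∂α with hA
  set B := ∫ y, ‖ψ y‖ ^ 2 ∂β with hB
  set c := ∫ p, V p ∂π with hc
  set W := ∫ p, w p ∂π with hW
  have i1 : Integrable (fun q : X × Y => ‖φ q.1‖ ^ 2) π := integrable_of_continuous (by fun_prop) π
  have i2 : Integrable (fun q : X × Y => ‖ψ q.2‖ ^ 2) π := integrable_of_continuous (by fun_prop) π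
  have i3 : Integrable w π := integrable_of_continuous (by fun_prop) π
  have i4 : Integrable (fun q : X × Y => ψ q.2) π := integrable_of_continuous (by fun_prop) π
  have i5 : Integrable (fun q : X × Y => φ q.1) π := integrable_of_continuous (by fun_prop) π
  have i6 : Integrable (fun q : X × Y => ‖φ q.1‖ ^ 2 • ψ q.2) π :=
    integrable_of_continuous (by fun_prop) π
  have i7 : Integrable (fun q : X × Y => ‖ψ q.2‖ ^ 2 • φ q.1) π :=
    integrable_of_continuous (by fun_prop) π
  have i8 : Integrable V π := integrable_of_continuous hVc π
  have hB2 : ∫ q, ‖ψ q.2‖ ^ 2 ∂π = B := integral_snd_of_mem_couplings hπ (f := fun y => ‖ψ y‖ ^ 2) (by fun_prop)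
  have hA2 : ∫ q, ‖φ q.1‖ ^ 2 ∂π = A := integral_fst_of_mem_couplings hπ (f := fun x => ‖φ x‖ ^ 2) (by fun_prop)
  have hψ2 : ∫ q, ψ q.2 ∂π = 0 := (integral_snd_of_mem_couplings hπ hψ).trans hψ0
  have hφ2 : ∫ q, φ q.1 ∂π = 0 := (integral_fst_of_mem_couplings hπ hφ).trans hφ0
  have hinner : ∀ p : X × Y, ∫ q, ‖φ p.1 - φ q.1‖ ^ 2 * ‖ψ p.2 - ψ q.2‖ ^ 2 ∂π
      = w p + W + B * ‖φ p.1‖ ^ 2 + A * ‖ψ p.2‖ ^ 2 - 2 * ⟪ψ p.2, m₁⟫ - 2 * ⟪φ p.1, m₂⟫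
        + 4 * ⟪V p, c⟫ := by
    intro p
    have e : ∀ q : X × Y, ‖φ p.1 - φ q.1‖ ^ 2 * ‖ψ p.2 - ψ q.2‖ ^ 2
        = w p + w q + ‖φ p.1‖ ^ 2 * ‖ψ q.2‖ ^ 2 + ‖ψ p.2‖ ^ 2 * ‖φ q.1‖ ^ 2
          - 2 * ⟪‖φ p.1‖ ^ 2 • ψ p.2, ψ q.2⟫ - 2 * ⟪‖ψ p.2‖ ^ 2 • φ p.1, φ q.1⟫
          - 2 * ⟪ψ p.2, ‖φ q.1‖ ^ 2 • ψ q.2⟫ - 2 * ⟪φ p.1, ‖ψ q.2‖ ^ 2 • φ q.1⟫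
          + 4 * ⟪V p, V q⟫ := by
      intro q
      simp only [hV, hw, inner_outerFamily, norm_sub_sq_real, real_inner_smul_left,
        real_inner_smul_right]
      ring
    simp only [e]
    have k0 : Integrable (fun _ : X × Y => w p) π ∧ ∫ _, w p ∂π = w p :=
      ⟨integrable_const _, by simp⟩
    have k1 := integral_const_mul_of_eq ⟨i2, hB2⟩ (‖φ p.1‖ ^ 2)
    have k2 := integral_const_mul_of_eq ⟨i1, hA2⟩ (‖ψ p.2‖ ^ 2)
    have k := integral_add_of_eq (integral_sub_of_eq (integral_sub_of_eq (integral_sub_of_eq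
      (integral_sub_of_eq (integral_add_of_eq (integral_add_of_eq (integral_add_of_eq k0
        ⟨i3, hW.symm⟩) k1) k2)
      (integral_const_mul_inner_of_eq i4 hψ2 2 (‖φ p.1‖ ^ 2 • ψ p.2)))
      (integral_const_mul_inner_of_eq i5 hφ2 2 (‖ψ p.2‖ ^ 2 • φ p.1)))
      (integral_const_mul_inner_of_eq i6 hm₁.symm 2 (ψ p.2)))
      (integral_const_mul_inner_of_eq i7 hm₂.symm 2 (φ p.1)))
      (integral_const_mul_inner_of_eq i8 hc.symm 4 (V p))
    rw [k.2]
    simp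
    ring
  -- With the constant vectors on the left, the same integration lemmas apply in `p`. The `m₁` and
  -- `m₂` terms now vanish, again by centring.
  simp only [hinner, real_inner_comm m₁, real_inner_comm m₂, real_inner_comm c]
  have k0 : Integrable (fun _ : X × Y => W) π ∧ ∫ _, W ∂π = W := ⟨integrable_const _, by simp⟩
  have k1 := integral_const_mul_of_eq ⟨i1, hA2⟩ B
  have k2 := integral_const_mul_of_eq ⟨i2, hB2⟩ A
  have k := integral_add_of_eq (integral_sub_of_eq (integral_sub_of_eq (integral_add_of_eq
    (integral_add_of_eq (integral_add_of_eq ⟨i3, hW.symm⟩ k0) k1) k2)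
    (integral_const_mul_inner_of_eq i4 hψ2 2 m₁))
    (integral_const_mul_inner_of_eq i5 hφ2 2 m₂))
    (integral_const_mul_inner_of_eq i8 hc.symm 4 c)
  rw [k.2, real_inner_self_eq_norm_sq]
  simp
  ring

/-- The Gromov–Wasserstein loss in terms of the embeddings. -/
theorem gwLoss_eq [SecondCountableTopology X] {cX : X → X → ℝ} {cY : Y → Y → ℝ} {φ : X → H} {ψ : Y → K}
    (hcX : ∀ x x', cX x x' = ‖φ x - φ x'‖ ^ 2) (hcY : ∀ y y', cY y y' = ‖ψ y - ψ y'‖ ^ 2)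
    (hφ : Continuous φ) (hψ : Continuous ψ)
    {α : Measure X} {β : Measure Y} [IsProbabilityMeasure α] [IsProbabilityMeasure β]
    {π : Measure (X × Y)} (hπ : π ∈ couplings α β)
    (hφ0 : ∫ x, φ x ∂α = 0) (hψ0 : ∫ y, ψ y ∂β = 0) :
    0 ≤ gwConst α β φ ψ + 8 * reducedObjective φ ψ π ∧
    gwLoss cX cY π = ENNReal.ofReal (gwConst α β φ ψ + 8 * reducedObjective φ ψ π) := by
  have := isProbabilityMeasure_of_mem_couplings hπ
  set f1 : (X × Y) × (X × Y) → ℝ := fun z => ‖φ z.1.1 - φ z.2.1‖ ^ 4 with hf1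
  set f2 : (X × Y) × (X × Y) → ℝ := fun z => ‖ψ z.1.2 - ψ z.2.2‖ ^ 4 with hf2
  set f3 : (X × Y) × (X × Y) → ℝ :=
    fun z => ‖φ z.1.1 - φ z.2.1‖ ^ 2 * ‖ψ z.1.2 - ψ z.2.2‖ ^ 2 with hf3
  have i1 : Integrable f1 (π.prod π) := integrable_of_continuous (by fun_prop) _
  have i2 : Integrable f2 (π.prod π) := integrable_of_continuous (by fun_prop) _
  have i3 : Integrable f3 (π.prod π) := integrable_of_continuous (by fun_prop) _
  set g : (X × Y) × (X × Y) → ℝ := fun z => f1 z + f2 z - 2 * f3 z with hg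
  have hgi : Integrable g (π.prod π) := (i1.add i2).sub (i3.const_mul 2)
  have hgsq : ∀ p q : X × Y, (cX p.1 q.1 - cY p.2 q.2) ^ 2 = g (p, q) := by
    intro p q
    simp only [hcX, hcY, hg, hf1, hf2, hf3]
    ring
  have hg0 : ∀ z, 0 ≤ g z := fun z => by
    rw [← hgsq z.1 z.2]
    positivity
  -- The integrand depends only on the first components, whose law under `π ⊗ π` is `α ⊗ α`.
  have e1 : ∫ z, f1 z ∂(π.prod π) = ∫ x, ∫ x', ‖φ x - φ x'‖ ^ 4 ∂α ∂α := by
    have hm : Measurable (Prod.map (Prod.fst : X × Y → X) (Prod.fst : X × Y → X)) := by fun_prop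
    have hc : Continuous fun z : X × X => ‖φ z.1 - φ z.2‖ ^ 4 := by fun_prop
    have hi := integrable_of_continuous hc (α.prod α)
    have hmap : (π.prod π).map (Prod.map Prod.fst Prod.fst) = α.prod α := by
      rw [← Measure.map_prod_map _ _ measurable_fst measurable_fst, hπ.1]
    rw [← integral_prod (fun z : X × X => ‖φ z.1 - φ z.2‖ ^ 4) hi, ← hmap,
      integral_map hm.aemeasurable hc.aestronglyMeasurable]
    rfl
  have e2 : ∫ z, f2 z ∂(π.prod π) = ∫ y, ∫ y', ‖ψ y - ψ y'‖ ^ 4 ∂β ∂β := by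
    have hm : Measurable (Prod.map (Prod.snd : X × Y → Y) (Prod.snd : X × Y → Y)) := by fun_prop
    have hc : Continuous fun z : Y × Y => ‖ψ z.1 - ψ z.2‖ ^ 4 := by fun_prop
    have hi := integrable_of_continuous hc (β.prod β)
    have hmap : (π.prod π).map (Prod.map Prod.snd Prod.snd) = β.prod β := by
      rw [← Measure.map_prod_map _ _ measurable_snd measurable_snd, hπ.2]
    rw [← integral_prod (fun z : Y × Y => ‖ψ z.1 - ψ z.2‖ ^ 4) hi, ← hmap,
      integral_map hm.aemeasurable hc.aestronglyMeasurable]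
    rfl
  have e3 : ∫ z, f3 z ∂(π.prod π) = _ :=
    (integral_prod f3 i3).trans (integral_cost_mul_cost hφ hψ hπ hφ0 hψ0)
  -- Doubling and subtracting the cross term gives `-4 ∫ ‖φ‖² ‖ψ‖² dπ - 8 ‖V_π‖²`, which is `8 *
  -- reducedObjective`, and a product of second moments that goes into `gwConst`.
  have htot : ∫ z, g z ∂(π.prod π) = gwConst α β φ ψ + 8 * reducedObjective φ ψ π := by
    have k := integral_sub_of_eq (integral_add_of_eq ⟨i1, e1⟩ ⟨i2, e2⟩)
      (integral_const_mul_of_eq ⟨i3, e3⟩ 2)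
    refine k.2.trans ?_
    rw [gwConst, reducedObjective]
    ring
  refine ⟨htot ▸ integral_nonneg hg0, ?_⟩
  rw [← htot, ofReal_integral_eq_lintegral_ofReal hgi (ae_of_all _ hg0),
    lintegral_prod _ hgi.aestronglyMeasurable.aemeasurable.ennreal_ofReal]
  simp only [gwLoss, hgsq]

end Expansion

end EGW

namespace EGW

open InformationTheory

/-! ### The decomposition on compact metrizable spaces -/

section Compact

variable {X Y H K : Type*} [MeasurableSpace X] [MeasurableSpace Y]
  [TopologicalSpace X] [BorelSpace X] [TopologicalSpace.MetrizableSpace X]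
  [CompactSpace X]
  [TopologicalSpace Y] [BorelSpace Y] [TopologicalSpace.MetrizableSpace Y]
  [SecondCountableTopology Y] [CompactSpace Y]
  [NormedAddCommGroup H] [InnerProductSpace ℝ H] [CompleteSpace H]
  [NormedAddCommGroup K] [InnerProductSpace ℝ K] [CompleteSpace K]

theorem continuous_alignment {X Y : Type*} [TopologicalSpace X] [TopologicalSpace Y] {φ : X → H}
    {ψ : Y → K} (hφ : Continuous φ) (hψ : Continuous ψ) (Γ : K →L[ℝ] H) :
    Continuous (alignment φ ψ Γ) := by
  simp only [funext (alignment_eq φ ψ Γ)]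
  fun_prop

/-- Completing the square in the operator variable. -/
theorem functional_eq {φ : X → H} {ψ : Y → K} (hφ : Continuous φ) (hψ : Continuous ψ)
    (α : Measure X) (β : Measure Y) (ε : ℝ) (Γ : K →L[ℝ] H) (hΓ : IsHilbertSchmidt Γ)
    (π : Measure (X × Y)) [IsProbabilityMeasure π] :
    functional α β φ ψ ε Γ π = ((ENNReal.ofReal ε * klDiv π (α.prod β) : ℝ≥0∞) : EReal)
      + ((reducedObjective φ ψ π
        + ‖hsFamily Γ hΓ - ∫ p, outerFamily (φ p.1) (ψ p.2) ∂π‖ ^ 2 : ℝ) : EReal) := by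
  set V : X × Y → lp (fun _ : basisIndex K => H) 2 := fun p => outerFamily (φ p.1) (ψ p.2) with hV
  have i1 : Integrable V π := integrable_of_continuous (continuous_outerFamily_comp hφ hψ) π
  have i2 : Integrable (fun p : X × Y => ‖φ p.1‖ ^ 2 * ‖ψ p.2‖ ^ 2) π :=
    integrable_of_continuous (by fun_prop) π
  have h1 := integral_add_of_eq (integral_const_mul_inner_of_eq i1 rfl 1 (hsFamily Γ hΓ))
    (integral_const_mul_of_eq ⟨i2, rfl⟩ (1 / 4))
  have h2 : ∫ p, alignment φ ψ Γ p ∂π = ⟪hsFamily Γ hΓ, ∫ p, V p ∂π⟫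
      + 1 / 4 * ∫ p, ‖φ p.1‖ ^ 2 * ‖ψ p.2‖ ^ 2 ∂π := by
    rw [← one_mul ⟪hsFamily Γ hΓ, ∫ p, V p ∂π⟫, ← h1.2]
    simp only [alignment_eq, hV, inner_hsFamily_outerFamily, one_mul]
  rw [functional, add_comm (hsNormSq Γ : EReal), sub_eq_add_neg, add_assoc, ← EReal.coe_neg,
    ← EReal.coe_add, h2, norm_sub_sq_real, norm_hsFamily_sq, reducedObjective]
  congr 2
  ring

/-- The squared norm `‖∫ V dρ‖²` is the integral of the scalar continuous kernel `⟪V p, V q⟫`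
against `ρ ⊗ ρ`, which depends continuously on `ρ`. No weak continuity of vector-valued integrals is
needed. -/
theorem continuous_reducedObjective [SecondCountableTopology X] {φ : X → H} {ψ : Y → K}
    (hφ : Continuous φ) (hψ : Continuous ψ) :
    Continuous fun ρ : ProbabilityMeasure (X × Y) => reducedObjective φ ψ ρ := by
  set V : X × Y → lp (fun _ : basisIndex K => H) 2 := fun p => outerFamily (φ p.1) (ψ p.2) with hV
  have hVc : Continuous V := continuous_outerFamily_comp hφ hψ
  have hk : Continuous fun z : (X × Y) × (X × Y) => ⟪V z.1, V z.2⟫ :=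
    (hVc.comp continuous_fst).inner (hVc.comp continuous_snd)
  have h1 : ∀ ρ : ProbabilityMeasure (X × Y), ‖∫ p, V p ∂(ρ : Measure (X × Y))‖ ^ 2
      = ∫ z, ⟪V z.1, V z.2⟫ ∂((ρ.prod ρ : ProbabilityMeasure _) : Measure ((X × Y) × (X × Y))) := by
    intro ρ
    have i1 : Integrable V (ρ : Measure (X × Y)) := integrable_of_continuous hVc _
    rw [ProbabilityMeasure.toMeasure_prod, integral_prod _ (integrable_of_continuous hk _)]
    simp only [integral_inner i1, real_inner_comm (∫ p, V p ∂(ρ : Measure (X × Y)))]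
    rw [real_inner_self_eq_norm_sq]
  have h2 := (ProbabilityMeasure.continuous_integral_continuousMap
    (⟨_, hk⟩ : C((X × Y) × (X × Y), ℝ))).comp
    (ProbabilityMeasure.continuous_prod.comp
      (continuous_id.prodMk (continuous_id (X := ProbabilityMeasure (X × Y)))))
  have h3 := ProbabilityMeasure.continuous_integral_continuousMap
    (⟨fun p => ‖φ p.1‖ ^ 2 * ‖ψ p.2‖ ^ 2, by fun_prop⟩ : C(X × Y, ℝ))
  refine Continuous.sub (Continuous.neg ?_) (h3.const_mul _)
  simp only [← hV, h1]
  exact h2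

/-- For fixed `Γ`, the part without entropy is affine and weakly continuous in `π`. The minimum is
finite because `α ⊗ β` has zero entropy. Outside the Hilbert–Schmidt class `hsNormSq Γ` is the
default value `0` of a divergent sum, still a constant. -/
theorem exists_isLeast_functional {φ : X → H} {ψ : Y → K} (hφ : Continuous φ)
    (hψ : Continuous ψ) (α : Measure X) (β : Measure Y) [IsProbabilityMeasure α]
    [IsProbabilityMeasure β] (ε : ℝ) (Γ : K →L[ℝ] H) :
    ∃ d : ℝ, IsLeast (functional α β φ ψ ε Γ '' couplings α β) (d : EReal) := by
  have hJ : ∀ π, functional α β φ ψ ε Γ π = ((ENNReal.ofReal ε * klDiv π (α.prod β) : ℝ≥0∞) : EReal)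
      + ((hsNormSq Γ - 2 * ∫ p, alignment φ ψ Γ p ∂π : ℝ) : EReal) := by
    intro π
    rw [functional, add_comm (hsNormSq Γ : EReal), sub_eq_add_neg, add_assoc, ← EReal.coe_neg,
      ← EReal.coe_add, ← sub_eq_add_neg]
  obtain ⟨π, hπ, hmin⟩ := exists_minimizer_couplings α β ε
    (fun π => hsNormSq Γ - 2 * ∫ p, alignment φ ψ Γ p ∂π)
    (continuous_const.sub ((ProbabilityMeasure.continuous_integral_continuousMap
      (⟨_, continuous_alignment hφ hψ Γ⟩ : C(X × Y, ℝ))).const_mul 2))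
  simp only [← hJ] at hmin
  have hbot : functional α β φ ψ ε Γ π ≠ ⊥ := by
    rw [hJ, Ne, EReal.add_eq_bot_iff, not_or]
    exact ⟨EReal.coe_ennreal_ne_bot _, EReal.coe_ne_bot _⟩
  have htop : functional α β φ ψ ε Γ π ≠ ⊤ := by
    refine ne_top_of_le_ne_top ?_ (hmin _ (prod_mem_couplings α β))
    rw [hJ, klDiv_self, mul_zero, EReal.coe_ennreal_zero, zero_add]
    exact EReal.coe_ne_top _
  refine ⟨(functional α β φ ψ ε Γ π).toReal, ?_⟩
  rw [EReal.coe_toReal htop hbot]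
  exact ⟨⟨π, hπ, rfl⟩, Set.forall_mem_image.2 hmin⟩

theorem ofReal_add_mul_ofReal {C R a : ℝ} (h : 0 ≤ C + 8 * R) (ha : 0 ≤ a) :
    ENNReal.ofReal (C + 8 * R) + 8 * ENNReal.ofReal a = ENNReal.ofReal (C + 8 * (a + R)) := by
  rw [show (8 : ℝ≥0∞) = ENNReal.ofReal 8 by simp, ← ENNReal.ofReal_mul (by norm_num),
    ← ENNReal.ofReal_add h (by positivity)]
  congr 1
  ring

/-- The decomposition of the entropic Gromov–Wasserstein cost on compact spaces. -/
theorem entropicGW_eq_of_compactSpace [SecondCountableTopology X]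
    {cX : X → X → ℝ} {cY : Y → Y → ℝ} {φ : X → H} {ψ : Y → K}
    (hcX : ∀ x x', cX x x' = ‖φ x - φ x'‖ ^ 2) (hcY : ∀ y y', cY y y' = ‖ψ y - ψ y'‖ ^ 2)
    (hφ : Continuous φ) (hψ : Continuous ψ) (α : Measure X) (β : Measure Y)
    [IsProbabilityMeasure α] [IsProbabilityMeasure β]
    (hφ0 : ∫ x, φ x ∂α = 0) (hψ0 : ∫ y, ψ y ∂β = 0) (ε : ℝ) :
    (∀ Γ : K →L[ℝ] H, ∀ π ∈ couplings α β, Integrable (alignment φ ψ Γ) π) ∧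
    ∃ (D : (K →L[ℝ] H) → ℝ) (m : ℝ),
      (∀ Γ : K →L[ℝ] H, IsLeast (functional α β φ ψ ε Γ '' couplings α β) (D Γ : EReal)) ∧
      IsLeast (D '' {Γ : K →L[ℝ] H | IsHilbertSchmidt Γ}) m ∧
      (entropicGW cX cY α β (8 * ε) : EReal) = ((gwConst α β φ ψ + 8 * m : ℝ) : EReal) := by
  refine ⟨fun Γ π hπ => ?_, ?_⟩
  · have := isProbabilityMeasure_of_mem_couplings hπ
    exact integrable_of_continuous (continuous_alignment hφ hψ Γ) π
  choose D hD using exists_isLeast_functional hφ hψ α β ε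
  obtain ⟨π, hπ, hmin⟩ := exists_minimizer_couplings α β ε _ (continuous_reducedObjective hφ hψ)
  have hπp := isProbabilityMeasure_of_mem_couplings hπ
  set A : Measure (X × Y) → ℝ≥0∞ := fun π => ENNReal.ofReal ε * klDiv π (α.prod β) with hA
  -- The competitor `α ⊗ β` has zero entropy and a finite objective.
  have hAtop : A π ≠ ∞ := by
    intro h
    have h0 := hmin _ (prod_mem_couplings α β)
    rw [show ENNReal.ofReal ε * klDiv π (α.prod β) = ∞ from h, klDiv_self, mul_zero,
      EReal.coe_ennreal_zero, zero_add, EReal.coe_ennreal_top, EReal.top_add_coe] at h0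
    exact EReal.coe_ne_top _ (top_le_iff.1 h0)
  have hcoe : ∀ {π'}, A π' ≠ ∞ → ∀ r : ℝ,
      ((A π' : EReal) + (r : EReal)) = (((A π').toReal + r : ℝ) : EReal) := by
    intro π' h r
    rw [EReal.coe_add, EReal.coe_ennreal_toReal h]
  set m : ℝ := (A π).toReal + reducedObjective φ ψ π with hm
  have hmE : (A π : EReal) + (reducedObjective φ ψ π : EReal) = (m : EReal) := hcoe hAtop _
  have hmin' : ∀ π' ∈ couplings α β, (m : EReal) ≤ (A π' : EReal) + (reducedObjective φ ψ π' : EReal) :=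
    fun π' hπ' => hmE ▸ hmin π' hπ'
  have hlow : ∀ Γ : K →L[ℝ] H, IsHilbertSchmidt Γ → m ≤ D Γ := by
    intro Γ hΓ
    obtain ⟨π', hπ', h⟩ := (hD Γ).1
    have := isProbabilityMeasure_of_mem_couplings hπ'
    rw [← EReal.coe_le_coe_iff, ← h, functional_eq hφ hψ α β ε Γ hΓ]
    refine (hmin' π' hπ').trans (add_le_add le_rfl (EReal.coe_le_coe_iff.2 ?_))
    exact le_add_of_nonneg_right (by positivity)
  have houter : Continuous fun p : X × Y => outer (φ p.1) (ψ p.2) :=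
    (InnerProductSpace.rankOne ℝ (E := H) (F := K)).continuous₂.comp (hφ.fst'.prodMk hψ.snd')
  -- The optimal operator is the average of `φ ψᵀ` under the optimal coupling, where the completed
  -- square vanishes.
  obtain ⟨T, hT, hTV⟩ := exists_hsFamily_integral_outerFamily (π := π)
    (u := fun p : X × Y => φ p.1) (v := fun p : X × Y => ψ p.2)
    (integrable_of_continuous (continuous_outerFamily_comp hφ hψ) π)
    (integrable_of_continuous houter π)
  have hDT : D T = m := by
    refine le_antisymm ?_ (hlow T hT)
    have := (hD T).2 ⟨π, hπ, rfl⟩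
    rw [functional_eq hφ hψ α β ε T hT, hTV, sub_self, norm_zero,
      zero_pow two_ne_zero, add_zero] at this
    rw [← EReal.coe_le_coe_iff, ← hmE]
    exact this
  refine ⟨D, m, hD, ⟨⟨T, hT, hDT⟩, Set.forall_mem_image.2 fun Γ hΓ => hlow Γ hΓ⟩, ?_⟩
  have hval : ∀ π' ∈ couplings α β,
      gwLoss cX cY π' + ENNReal.ofReal (8 * ε) * klDiv π' (α.prod β)
        = ENNReal.ofReal (gwConst α β φ ψ + 8 * reducedObjective φ ψ π') + 8 * A π' := by
    intro π' hπ'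
    rw [(gwLoss_eq hcX hcY hφ hψ hπ' hφ0 hψ0).2, ENNReal.ofReal_mul (by norm_num), hA, mul_assoc]
    simp
  have hnn := (gwLoss_eq hcX hcY hφ hψ hπ hφ0 hψ0).1
  have hvalπ : gwLoss cX cY π + ENNReal.ofReal (8 * ε) * klDiv π (α.prod β)
      = ENNReal.ofReal (gwConst α β φ ψ + 8 * m) := by
    rw [hval π hπ, ← ENNReal.ofReal_toReal hAtop,
      ofReal_add_mul_ofReal hnn ENNReal.toReal_nonneg]
  have hGW : entropicGW cX cY α β (8 * ε) = ENNReal.ofReal (gwConst α β φ ψ + 8 * m) := by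
    refine le_antisymm ((iInf₂_le π hπ).trans hvalπ.le) (le_iInf₂ fun π' hπ' => ?_)
    rw [hval π' hπ']
    by_cases h : A π' = ∞
    · simp [h, ENNReal.mul_top]
    · rw [← ENNReal.ofReal_toReal h, ofReal_add_mul_ofReal
        (gwLoss_eq hcX hcY hφ hψ hπ' hφ0 hψ0).1 ENNReal.toReal_nonneg]
      have h1 := hmin' π' hπ'
      rw [hcoe h, EReal.coe_le_coe_iff] at h1
      exact ENNReal.ofReal_le_ofReal (by linarith)
  -- `ENNReal.ofReal` truncates at zero, so the nonnegativity of the loss is needed to return to the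
  -- real value.
  rw [hGW, EReal.coe_ennreal_ofReal, max_eq_left]
  have := ENNReal.toReal_nonneg (a := A π)
  rw [hm]
  linarith

end Compact

end EGW

namespace EGW

open InformationTheory

/-! ### Invariance under measurable embeddings -/

section Transfer

variable {X Y X' Y' H K : Type*} [MeasurableSpace X] [MeasurableSpace Y]
  [MeasurableSpace X'] [MeasurableSpace Y']
  [NormedAddCommGroup H] [InnerProductSpace ℝ H]
  [NormedAddCommGroup K] [InnerProductSpace ℝ K] [CompleteSpace K]
  {i : X' → X} {j : Y' → Y} {α' : Measure X'} {β' : Measure Y'}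

theorem exists_measurable_retraction [Nonempty X'] (hi : MeasurableEmbedding i) (α' : Measure X') :
    ∃ r : X → X', Measurable r ∧ (∀ x, r (i x) = x) ∧ ∀ᵐ x ∂(α'.map i), i (r x) = x := by
  obtain ⟨r, hr, hri⟩ := hi.exists_measurable_extend measurable_id fun _ => inferInstance
  refine ⟨r, hr, congrFun hri, hi.ae_map_iff.2 (ae_of_all _ fun x => ?_)⟩
  rw [show r (i x) = x from congrFun hri x]

variable [IsProbabilityMeasure α'] [IsProbabilityMeasure β']

/-- The marginals of `π` are carried by the ranges of `i` and `j`, so the product of the two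
retractions inverts `Prod.map i j` also on the other side, `π`-almost everywhere. The same `r`
serves every coupling. -/
theorem exists_measurable_leftInverse_prodMap (hi : MeasurableEmbedding i)
    (hj : MeasurableEmbedding j) : ∃ r : X × Y → X' × Y', Measurable r ∧
      (r ∘ Prod.map i j = id) ∧ ∀ π ∈ couplings (α'.map i) (β'.map j),
        π.map r ∈ couplings α' β' ∧ (π.map r).map (Prod.map i j) = π := by
  have := α'.nonempty_of_neZero
  have := β'.nonempty_of_neZero
  obtain ⟨r, hr, hri, hir⟩ := exists_measurable_retraction hi α'
  obtain ⟨s, hs, hsj, hjs⟩ := exists_measurable_retraction hj β'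
  have hrs : Measurable (Prod.map r s) := hr.prodMap hs
  refine ⟨Prod.map r s, hrs, funext fun p => Prod.ext (hri p.1) (hsj p.2), fun π hπ => ⟨⟨?_, ?_⟩, ?_⟩⟩
  · rw [Measure.map_map measurable_fst hrs, show Prod.fst ∘ Prod.map r s = r ∘ Prod.fst from rfl,
      ← Measure.map_map hr measurable_fst, hπ.1, Measure.map_map hr hi.measurable,
      show r ∘ i = id from funext hri, Measure.map_id]
  · rw [Measure.map_map measurable_snd hrs, show Prod.snd ∘ Prod.map r s = s ∘ Prod.snd from rfl,
      ← Measure.map_map hs measurable_snd, hπ.2, Measure.map_map hs hj.measurable,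
      show s ∘ j = id from funext hsj, Measure.map_id]
  · rw [Measure.map_map (hi.measurable.prodMap hj.measurable) hrs]
    rw [← hπ.1] at hir
    rw [← hπ.2] at hjs
    have h : Prod.map i j ∘ Prod.map r s =ᵐ[π] id := by
      filter_upwards [ae_of_ae_map measurable_fst.aemeasurable hir,
        ae_of_ae_map measurable_snd.aemeasurable hjs] with p h1 h2
      exact Prod.ext h1 h2
    rw [Measure.map_congr h, Measure.map_id]

theorem couplings_map (hi : MeasurableEmbedding i) (hj : MeasurableEmbedding j) :
    couplings (α'.map i) (β'.map j) = Measure.map (Prod.map i j) '' couplings α' β' := by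
  obtain ⟨r, -, -, h⟩ := exists_measurable_leftInverse_prodMap (α' := α') (β' := β') hi hj
  have hij := hi.measurable.prodMap hj.measurable
  refine Set.Subset.antisymm (fun π hπ => ⟨π.map r, h π hπ⟩) ?_
  rintro _ ⟨ρ, hρ, rfl⟩
  constructor
  · rw [Measure.map_map measurable_fst hij, ← hρ.1, Measure.map_map hi.measurable measurable_fst]
    rfl
  · rw [Measure.map_map measurable_snd hij, ← hρ.2, Measure.map_map hj.measurable measurable_snd]
    rfl

/-- Data processing inequality, applied along `Prod.map i j` and then along its measurable left
inverse. -/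
theorem klDiv_map_prodMap (hi : MeasurableEmbedding i) (hj : MeasurableEmbedding j)
    (ρ : Measure (X' × Y')) [IsFiniteMeasure ρ] :
    klDiv (ρ.map (Prod.map i j)) ((α'.map i).prod (β'.map j)) = klDiv ρ (α'.prod β') := by
  obtain ⟨r, hr, hre, -⟩ := exists_measurable_leftInverse_prodMap (α' := α') (β' := β') hi hj
  have hij := hi.measurable.prodMap hj.measurable
  have e : ∀ μ : Measure (X' × Y'), (μ.map (Prod.map i j)).map r = μ := fun μ => by
    rw [Measure.map_map hr hij, hre, Measure.map_id]
  rw [Measure.map_prod_map _ _ hi.measurable hj.measurable]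
  refine le_antisymm (klDiv_map_le _ _ hij) ?_
  have h := klDiv_map_le (ρ.map (Prod.map i j)) ((α'.prod β').map (Prod.map i j)) hr
  rwa [e, e] at h

theorem functional_map (hi : MeasurableEmbedding i) (hj : MeasurableEmbedding j)
    (φ : X → H) (ψ : Y → K) (ε : ℝ) (Γ : K →L[ℝ] H) (ρ : Measure (X' × Y')) [IsFiniteMeasure ρ] :
    functional (α'.map i) (β'.map j) φ ψ ε Γ (ρ.map (Prod.map i j))
      = functional α' β' (φ ∘ i) (ψ ∘ j) ε Γ ρ := by
  rw [functional, functional, klDiv_map_prodMap hi hj, (hi.prodMap hj).integral_map]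
  rfl

theorem image_functional_map (hi : MeasurableEmbedding i) (hj : MeasurableEmbedding j)
    (φ : X → H) (ψ : Y → K) (ε : ℝ) (Γ : K →L[ℝ] H) :
    functional (α'.map i) (β'.map j) φ ψ ε Γ '' couplings (α'.map i) (β'.map j)
      = functional α' β' (φ ∘ i) (ψ ∘ j) ε Γ '' couplings α' β' := by
  rw [couplings_map hi hj, Set.image_image]
  refine Set.image_congr fun ρ hρ => ?_
  have := isProbabilityMeasure_of_mem_couplings hρ
  exact functional_map hi hj φ ψ ε Γ ρ

theorem entropicGW_map (hi : MeasurableEmbedding i) (hj : MeasurableEmbedding j)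
    (cX : X → X → ℝ) (cY : Y → Y → ℝ) (τ : ℝ) :
    entropicGW cX cY (α'.map i) (β'.map j) τ
      = entropicGW (fun x x' => cX (i x) (i x')) (fun y y' => cY (j y) (j y')) α' β' τ := by
  rw [entropicGW, couplings_map hi hj, iInf_image, entropicGW]
  refine iInf_congr fun ρ => iInf_congr fun hρ => ?_
  have := isProbabilityMeasure_of_mem_couplings hρ
  rw [klDiv_map_prodMap hi hj]
  simp only [gwLoss, (hi.prodMap hj).lintegral_map]
  rfl

end Transfer

theorem gwConst_map {X Y X' Y' H K : Type*} [MeasurableSpace X] [MeasurableSpace Y]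
    [MeasurableSpace X'] [MeasurableSpace Y'] [NormedAddCommGroup H] [NormedAddCommGroup K]
    {i : X' → X} {j : Y' → Y} {α' : Measure X'} {β' : Measure Y'}
    (hi : MeasurableEmbedding i) (hj : MeasurableEmbedding j) (φ : X → H) (ψ : Y → K) :
    gwConst (α'.map i) (β'.map j) φ ψ = gwConst α' β' (φ ∘ i) (ψ ∘ j) := by
  simp only [gwConst, hi.integral_map, hj.integral_map, Function.comp]

/-! ### Compact metrizable models and the general theorem -/

theorem IsCentredEmbedding.continuous {X H : Type*} [TopologicalSpace X] [MeasurableSpace X]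
    [NormedAddCommGroup H] [InnerProductSpace ℝ H] {c : X → X → ℝ} {α : Measure X} {φ : X → H}
    (hφ : IsCentredEmbedding c α φ) (hc : IsDefiniteCNT c) : Continuous φ := by
  rw [continuous_iff_continuousAt]
  intro x
  rw [ContinuousAt, tendsto_iff_norm_sub_tendsto_zero]
  have h1 : Continuous fun y => √(c y x) :=
    (hc.continuous.comp (continuous_id.prodMk continuous_const)).sqrt
  simpa only [hφ.cost_eq, Real.sqrt_sq (norm_nonneg _), sub_self, norm_zero,
    zero_pow two_ne_zero, Real.sqrt_zero] using h1.tendsto x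

theorem IsCentredEmbedding.injective {X H : Type*} [TopologicalSpace X] [MeasurableSpace X]
    [NormedAddCommGroup H] [InnerProductSpace ℝ H] {c : X → X → ℝ} {α : Measure X} {φ : X → H}
    (hφ : IsCentredEmbedding c α φ) (hc : IsDefiniteCNT c) : Function.Injective φ :=
  fun x y h => hc.definite x y (by rw [hφ.cost_eq, h]; simp)

/-- A compactly supported measure on a space with a definite cost is the image of a measure on a
compact metrizable space. -/
theorem IsCentredEmbedding.exists_compact_model {X : Type*} {H : Type*} [TopologicalSpace X]
    [MeasurableSpace X] [BorelSpace X] [NormedAddCommGroup H] [InnerProductSpace ℝ H]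
    {c : X → X → ℝ} {α : Measure X} [IsProbabilityMeasure α] {φ : X → H}
    (hφ : IsCentredEmbedding c α φ) (hc : IsDefiniteCNT c) (hα : HasCompactSupport α) :
    ∃ (s : Set X) (α' : Measure s), CompactSpace s ∧ TopologicalSpace.MetrizableSpace s ∧
      SecondCountableTopology s ∧ IsProbabilityMeasure α' ∧
      MeasurableEmbedding ((↑) : s → X) ∧ α'.map (↑) = α := by
  have hcont := hφ.continuous hc
  have hinj := hφ.injective hc
  -- Separation is inherited from the Hilbert space. It makes the compact carrier closed, hence
  -- Borel.
  have : T2Space X := T2Space.of_injective_continuous hinj hcont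
  obtain ⟨s, hs, hs0⟩ := hα
  have hcs : CompactSpace s := isCompact_iff_compactSpace.1 hs
  -- A continuous injection from a compact space into a Hausdorff one is a closed embedding, so `s`
  -- inherits metrizability from the Hilbert space.
  have hemb : Topology.IsClosedEmbedding (φ ∘ ((↑) : s → X)) :=
    (hcont.comp continuous_subtype_val).isClosedEmbedding (hinj.comp Subtype.val_injective)
  have hmet : TopologicalSpace.MetrizableSpace s := hemb.isEmbedding.metrizableSpace
  have hsc : SecondCountableTopology s := by
    let _ := TopologicalSpace.metrizableSpaceMetric s
    infer_instance
  have hme : MeasurableEmbedding ((↑) : s → X) := MeasurableEmbedding.subtype_coe hs.measurableSet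
  have hmap : (α.comap ((↑) : s → X)).map (↑) = α := by
    rw [hme.map_comap, Subtype.range_coe, Measure.restrict_eq_self_of_ae_mem]
    exact mem_ae_iff.mpr hs0
  refine ⟨s, α.comap Subtype.val, hcs, hmet, hsc, ?_, hme, hmap⟩
  have : IsProbabilityMeasure ((α.comap (Subtype.val : s → X)).map Subtype.val) := by rwa [hmap]
  exact Measure.isProbabilityMeasure_of_map (Subtype.val : s → X)

end EGW

theorem mainTheorem1
    {X Y HX HY : Type*}
    [TopologicalSpace X] [MeasurableSpace X] [BorelSpace X]
    [TopologicalSpace Y] [MeasurableSpace Y] [BorelSpace Y]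
    [NormedAddCommGroup HX] [InnerProductSpace ℝ HX] [CompleteSpace HX]
    [NormedAddCommGroup HY] [InnerProductSpace ℝ HY] [CompleteSpace HY]
    (cX : X → X → ℝ) (cY : Y → Y → ℝ)
    (hcX : EGW.IsDefiniteCNT cX) (hcY : EGW.IsDefiniteCNT cY)
    (α : Measure X) [IsProbabilityMeasure α] (hα : EGW.HasCompactSupport α)
    (β : Measure Y) [IsProbabilityMeasure β] (hβ : EGW.HasCompactSupport β)
    (φ : X → HX) (hφ : EGW.IsCentredEmbedding cX α φ)
    (ψ : Y → HY) (hψ : EGW.IsCentredEmbedding cY β ψ)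
    (ε : ℝ) (hε : 0 ≤ ε) :
    (∀ Γ : HY →L[ℝ] HX, EGW.IsHilbertSchmidt Γ → ∀ π ∈ EGW.couplings α β,
      Integrable (EGW.alignment φ ψ Γ) π) ∧
    ∃ (D : (HY →L[ℝ] HX) → ℝ) (m : ℝ),
      (∀ Γ : HY →L[ℝ] HX, EGW.IsHilbertSchmidt Γ →
        IsLeast (EGW.functional α β φ ψ ε Γ '' EGW.couplings α β) (D Γ : EReal)) ∧
      IsLeast (D '' {Γ : HY →L[ℝ] HX | EGW.IsHilbertSchmidt Γ}) m ∧
      (EGW.entropicGW cX cY α β (8 * ε) : EReal)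
        = ((EGW.gwConst α β φ ψ + 8 * m : ℝ) : EReal) := by
  -- From here `α`, and next `β`, are images of measures on compact metrizable spaces, and composing
  -- with the inclusions keeps the embeddings centred.
  obtain ⟨s, α', _, _, _, _, hi, rfl⟩ := hφ.exists_compact_model hcX hα
  obtain ⟨t, β', _, _, _, _, hj, rfl⟩ := hψ.exists_compact_model hcY hβ
  have hφ0 : ∫ x, (φ ∘ (↑)) x ∂α' = 0 := (hi.integral_map φ).symm.trans hφ.centred
  have hψ0 : ∫ y, (ψ ∘ (↑)) y ∂β' = 0 := (hj.integral_map ψ).symm.trans hψ.centred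
  obtain ⟨hint, D, m, hD, hm, hGW⟩ := EGW.entropicGW_eq_of_compactSpace
    (cX := fun x x' : s => cX x x') (cY := fun y y' : t => cY y y')
    (fun x x' => hφ.cost_eq x x') (fun y y' => hψ.cost_eq y y')
    ((hφ.continuous hcX).comp continuous_subtype_val)
    ((hψ.continuous hcY).comp continuous_subtype_val) α' β' hφ0 hψ0 ε
  refine ⟨fun Γ _ π hπ => ?_, D, m, fun Γ _ => ?_, hm, ?_⟩
  · rw [EGW.couplings_map hi hj] at hπ
    obtain ⟨ρ, hρ, rfl⟩ := hπ
    exact (hi.prodMap hj).integrable_map_iff.2 (hint Γ ρ hρ)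
  · rw [EGW.image_functional_map hi hj]
    exact hD Γ
  · rw [EGW.entropicGW_map hi hj, EGW.gwConst_map hi hj]
    exact hGW
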